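/- **Conventions.** A Euclidean polyhedron is a closed subpolyhedron $X$ of some $\mathbb R^N$ (the underlying space of a locally finite simplicial complex) with the induced metric. For $A\subset X$ let $\mathcal H_A(X)$ be the group of homeomorphisms $h$ of $X$ onto itself with $h|_A=\mathrm{id}$, with the compact-open topology. Let $\mathcal H_A^{\rm loc\,LIP}(X)$, $\mathcal H_A^{\rm LIP}(X)$, $\mathcal H_A^{\rm PL}(X)$ be the subgroups of those $h$ for which $h$ and $h^{-1}$ are, respectively, locally Lipschitz, Lipschitz, piecewise linear; a superscript $c$ means that in addition $h$ has compact support. Let $s=\mathbb R^\infty$, $\Sigma=\{(x_n)\in s:\sup_n|x_n|<\infty\}$, $\sigma=\{(x_n)\in s: x_n=0\text{ for almost all }n\}$ (all but finitely many $n$), and for $E=\Sigma,\sigma$ let $E^\infty_f=\{(x_n)\in E^\infty: x_n=0\text{ for almost all }n\}$; let $s^\infty_b=\{(x_n)\in s^\infty:\sup_{n,i}|(x_n)_i|<\infty\}$. A tuple $(Y_0,\dots,Y_5)$ of a space $Y_0$ and subspaces $Y_i\subset Y_0$ is $(E_0,\dots,E_5)$-stable if there is a homeomorphism $\Phi:Y_0\times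 E_0\to Y_0$ with $\Phi(Y_i\times E_i)=Y_i$ for all $i$; such a $\Phi$ is called a stability homeomorphism. For a group $Y$ of homeomorphisms, $(Y)_0$ is the connected component of the identity in $Y$. **Proposition 4.1.** Let $X$ be a Euclidean polyhedron and $A$ a compact subpolyhedron of $X$ with $\dim(X\setminus A)\ge 1$. (i) The tuple $\bigl(\mathcal H_A(X),\mathcal H_A^{\rm loc\,LIP}(X),\mathcal H_A^{\rm LIP}(X),\mathcal H_A^{\rm LIP,c}(X),\mathcal H_A^{\rm PL}(X),\mathcal H_A^{\rm PL,c}(X)\bigr)$ is $(s,\Sigma,\Sigma,\Sigma,\sigma,\sigma)$-stable. (ii) If $X$ is noncompact and $\dim(X\setminus K)\ge 1$ for every compact subset $K$ of $X$, then this tuple is $(s^\infty,\Sigma^\infty,s^\infty_b,\Sigma^\infty_f,\sigma^\infty,\sigma^\infty_f)$-stable. For each triangulation of $X$, the condition that $\dim(X\setminus K)\ge1$ for every compact $K\subset X$ holds if and only if that triangulation contains infinitely many $1$-simplices. In both cases the stability homeomorphism $\Phi$ can be chosen so that it preserves the identity components: $\Phi\bigl((Y_i)_0\times E_i\bigr)=(Y_i)_0$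 for each of the six groups $Y_i$ of the tuple and the corresponding entry $E_i$ of the model tuple. -/

import Mathlib

open Set Topology

/-! ### Polyhedra in Euclidean space -/

/-- `T` is a (linear) triangulation of the closed set `X ⊆ ℝ^N`: a simplicial complex,
locally finite in `ℝ^N`, whose underlying space is `X`. -/
def IsTriangulation {N : ℕ} (T : Geometry.SimplicialComplex ℝ (EuclideanSpace ℝ (Fin N)))
    (X : Set (EuclideanSpace ℝ (Fin N))) : Prop :=
  LocallyFinite (fun s : T.faces =>
    convexHull ℝ ((s : Finset (EuclideanSpace ℝ (Fin N))) : Set (EuclideanSpace ℝ (Fin N)))) ∧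
  T.space = X

/-- A (closed) subpolyhedron of `ℝ^N`. -/
def IsEuclideanPolyhedron {N : ℕ} (X : Set (EuclideanSpace ℝ (Fin N))) : Prop :=
  ∃ T : Geometry.SimplicialComplex ℝ (EuclideanSpace ℝ (Fin N)), IsTriangulation T X

/-- The 1-simplices of a simplicial complex, given by their vertex sets. -/
def oneSimplices {N : ℕ} (T : Geometry.SimplicialComplex ℝ (EuclideanSpace ℝ (Fin N))) :
    Set (Finset (EuclideanSpace ℝ (Fin N))) :=
  {s | s ∈ T.faces ∧ s.card = 2}

/-- A convex linear cell: a compact set cut out by finitely many affine inequalities. -/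
def IsConvexCell {N : ℕ} (C : Set (EuclideanSpace ℝ (Fin N))) : Prop :=
  IsCompact C ∧ ∃ G : Set (EuclideanSpace ℝ (Fin N) →ᵃ[ℝ] ℝ), G.Finite ∧
    C = {x | ∀ g ∈ G, 0 ≤ g x}

/-- A piecewise linear self-map of `X`: continuous, and affine on each cell of some locally
finite cover of `X` by convex linear cells (such a cover can always be subdivided to a
triangulation of `X`, so this is the same as being affine on the simplices of one). -/
def IsPLMap {N : ℕ} {X : Set (EuclideanSpace ℝ (Fin N))} (f : X → X) : Prop :=
  Continuous f ∧ ∃ 𝒞 : Set (Set (EuclideanSpace ℝ (Fin N))),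
    (∀ C ∈ 𝒞, IsConvexCell C) ∧
    LocallyFinite (fun C : 𝒞 => (C : Set (EuclideanSpace ℝ (Fin N)))) ∧
    ⋃₀ 𝒞 = X ∧
    ∀ C ∈ 𝒞, ∃ a : EuclideanSpace ℝ (Fin N) →ᵃ[ℝ] EuclideanSpace ℝ (Fin N),
      ∀ x : X, (x : EuclideanSpace ℝ (Fin N)) ∈ C → (f x : EuclideanSpace ℝ (Fin N)) = a x

/-! ### Homeomorphism groups -/

/-- The compact-open topology on the group of homeomorphisms of a space onto itself. -/
instance homeomorphCompactOpen {X : Type*} [TopologicalSpace X] : TopologicalSpace (X ≃ₜ X) :=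
  TopologicalSpace.induced (fun h : X ≃ₜ X => (⟨h, h.continuous⟩ : C(X, X)))
    ContinuousMap.compactOpen

/-- `𝓗_A(X)`: the group of homeomorphisms of `X` onto itself which are the identity on `A`;
it carries the compact-open topology (as a subspace). -/
def homeoRel {N : ℕ} (X A : Set (EuclideanSpace ℝ (Fin N))) : Subgroup (X ≃ₜ X) where
  carrier := {h | ∀ x : X, (x : EuclideanSpace ℝ (Fin N)) ∈ A → h x = x}
  one_mem' := fun _ _ => rfl
  mul_mem' := by
    intro g h hg hh x hx
    change g (h x) = x
    rw [hh x hx, hg x hx]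
  inv_mem' := by
    intro h hh x hx
    change h.symm x = x
    rw [Homeomorph.symm_apply_eq, hh x hx]

section Groups

variable {N : ℕ} (X A : Set (EuclideanSpace ℝ (Fin N)))

/-- `𝓗_A^{loc LIP}(X)`. -/
def homeoLocLip : Set (homeoRel X A) :=
  {h | LocallyLipschitz (h : X ≃ₜ X) ∧ LocallyLipschitz (h : X ≃ₜ X).symm}

/-- `𝓗_A^{LIP}(X)`. -/
def homeoLip : Set (homeoRel X A) :=
  {h | (∃ K, LipschitzWith K (h : X ≃ₜ X)) ∧ ∃ K, LipschitzWith K (h : X ≃ₜ X).symm}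

/-- `𝓗_A^{PL}(X)`. -/
def homeoPL : Set (homeoRel X A) :=
  {h | IsPLMap (h : X ≃ₜ X) ∧ IsPLMap (h : X ≃ₜ X).symm}

/-- The elements of `𝓗_A(X)` with compact support. -/
def homeoCompactSupport : Set (homeoRel X A) :=
  {h | IsCompact (closure {x : X | (h : X ≃ₜ X) x ≠ x})}

/-- The 6-tuple `(𝓗_A, 𝓗_A^{loc LIP}, 𝓗_A^{LIP}, 𝓗_A^{LIP,c}, 𝓗_A^{PL}, 𝓗_A^{PL,c})`. -/
def homeoTuple : Fin 6 → Set (homeoRel X A) :=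
  ![univ, homeoLocLip X A, homeoLip X A, homeoLip X A ∩ homeoCompactSupport X A,
    homeoPL X A, homeoPL X A ∩ homeoCompactSupport X A]

end Groups

/-! ### Model spaces: `s = ℕ → ℝ` and `s^∞ = ℕ → ℕ → ℝ`, with the product topologies -/

/-- `Σ`, the bounded sequences. -/
def modelSigma : Set (ℕ → ℝ) := {x | ∃ B : ℝ, ∀ n, |x n| ≤ B}

/-- `σ`, the finitely supported sequences. -/
def modelFin : Set (ℕ → ℝ) := {x | {n | x n ≠ 0}.Finite}

/-- `E^∞ ⊆ s^∞` for `E ⊆ s`. -/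
def seqIn (E : Set (ℕ → ℝ)) : Set (ℕ → ℕ → ℝ) := {x | ∀ n, x n ∈ E}

/-- `E^∞_f`: the sequences in `E^∞` almost all of whose entries vanish. -/
def seqInFin (E : Set (ℕ → ℝ)) : Set (ℕ → ℕ → ℝ) := {x | x ∈ seqIn E ∧ {n | x n ≠ 0}.Finite}

/-- `s^∞_b`: the uniformly bounded elements of `s^∞`. -/
def seqBounded : Set (ℕ → ℕ → ℝ) := {x | ∃ B : ℝ, ∀ n i, |x n i| ≤ B}

/-- `(s, Σ, Σ, Σ, σ, σ)`. -/
def modelTuple : Fin 6 → Set (ℕ → ℝ) :=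
  ![univ, modelSigma, modelSigma, modelSigma, modelFin, modelFin]

/-- `(s^∞, Σ^∞, s^∞_b, Σ^∞_f, σ^∞, σ^∞_f)`. -/
def modelTupleInfty : Fin 6 → Set (ℕ → ℕ → ℝ) :=
  ![univ, seqIn modelSigma, seqBounded, seqInFin modelSigma, seqIn modelFin, seqInFin modelFin]

/-! ### Stability -/

/-- `Φ` is a homeomorphism of tuples `(Y₀ × E₀, Y₁ × E₁, …) ≅ (Y₀, Y₁, …)`; the total spaces
`Y` and `E` are themselves the first entries of the tuples used below. A tuple is
`(E₀, E₁, …)`-stable if there is such a homeomorphism. -/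
def IsStabilityHomeo {n : ℕ} {Y E : Type*} [TopologicalSpace Y] [TopologicalSpace E]
    (Yt : Fin n → Set Y) (Et : Fin n → Set E) (Φ : Y × E ≃ₜ Y) : Prop :=
  ∀ i, Φ '' (Yt i ×ˢ Et i) = Yt i

/-- `Φ ((Yᵢ)₀ × Eᵢ) = (Yᵢ)₀` for every `i`, where `(Yᵢ)₀` is the connected component of the
identity in the subspace `Yᵢ`. -/
def PreservesIdentityComponents {n : ℕ} {Y E : Type*} [TopologicalSpace Y] [TopologicalSpace E]
    [One Y] (Yt : Fin n → Set Y) (Et : Fin n → Set E) (Φ : Y × E ≃ₜ Y) : Prop :=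
  ∀ i, Φ '' (connectedComponentIn (Yt i) 1 ×ˢ Et i) = connectedComponentIn (Yt i) 1

/-! ### Simplices -/

/-! The idea is to split `homeoRel X A` as (slice) × E, where E is the model space, compatibly with
all the subgroups; since E × E ≅ E by interleaving, a further factor E is absorbed.

The hypothesis on dimension provides a point x of X off A near which X is invariant under small
translations in a direction e: an interior point of a simplex of positive dimension, chosen as large
as possible (`exists_isFlatAt`). Along the ray from x in direction e lie disjoint polyhedral double
cones shrinking geometrically to x. For a parameter t, `homeo t` slides each cone along its axis,
moving the midpoint of the n-th axis to the point with coordinate `squash (t n)` in (-1, 1).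

To read the parameters back from an arbitrary homeomorphism h, the image under h of each axis is cut
at its balance point, where both subarcs have the same `packSize`. This is a metric size of sets,
strictly monotone on nonempty compact sets (`packSize_lt`), so the balance point exists, is unique
and depends continuously on h. As the size sees only the image set, h ∘ `homeo t` is balanced at the
midpoints exactly when h is balanced at t (`par_mul_homeo_eq_zero_iff`). Hence h = s ∘ (`homeo t`)⁻¹
with t = `par h` and s in the slice `par s = 0`, uniquely.

Compatibility with the subgroups is checked in both directions. Bounded parameters give bi-Lipschitz
maps, as the tents then have bounded slope; a K-bi-Lipschitz h has parameters at most K²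
(`abs_balancePt_le`), and local bi-Lipschitz control at x reaches all but finitely many cells.
Finitely many nonzero parameters near each point give a PL map; a PL map is affine on an initial
piece of the ray, so almost all of its parameters vanish.

In (ii) the construction is repeated at a sequence of flat points going to infinity, which makes the
parameters a double sequence; compact support means that only finitely many rows are nonzero. The
resulting homeomorphism fixes the base point and the model spaces are star-shaped, so identity
components are preserved. -/

section Simplices

variable {N : ℕ}

/-- Barycentric coordinates of a simplex, extended to the ambient space. -/
theorem exists_barycentric_coords {s : Finset (EuclideanSpace ℝ (Fin N))}
    (hs : AffineIndependent ℝ ((↑) : s → EuclideanSpace ℝ (Fin N))) :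
    ∃ (t : Finset (EuclideanSpace ℝ (Fin N)))
      (c : EuclideanSpace ℝ (Fin N) → EuclideanSpace ℝ (Fin N) →ᵃ[ℝ] ℝ),
      s ⊆ t ∧ (∀ v ∈ t, c v v = 1) ∧ (∀ v ∈ t, ∀ u ∈ t, u ≠ v → c v u = 0) ∧
      convexHull ℝ (s : Set (EuclideanSpace ℝ (Fin N))) =
        {y | (∀ v ∈ t, 0 ≤ c v y) ∧ ∀ v ∈ t, v ∉ s → c v y = 0} := by
  classical
  -- Completing the vertices to an affine basis makes the coordinates affine on all of ℝ^N; the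
  -- coordinates of the added points then give the equations of the affine span of the simplex.
  obtain ⟨t', hst, hti, htop⟩ := exists_subset_affineIndependent_affineSpan_eq_top
    (k := ℝ) (s := (s : Set (EuclideanSpace ℝ (Fin N)))) hs
  have htf : t'.Finite := finite_set_of_fin_dim_affineIndependent ℝ hti
  obtain ⟨t, rfl⟩ := htf.exists_finset_coe
  have hst : s ⊆ t := by simpa using hst
  let b : AffineBasis t ℝ (EuclideanSpace ℝ (Fin N)) := ⟨fun v => v, hti, by
    simpa [Subtype.range_coe] using htop⟩
  have hb : ∀ v : t, b v = v := fun _ => rfl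
  let c : EuclideanSpace ℝ (Fin N) → EuclideanSpace ℝ (Fin N) →ᵃ[ℝ] ℝ :=
    fun v => if h : v ∈ t then b.coord ⟨v, h⟩ else AffineMap.const ℝ _ 0
  have hc : ∀ v (h : v ∈ t), c v = b.coord ⟨v, h⟩ := fun v h => dif_pos h
  have h1 : ∀ v ∈ t, c v v = 1 := by
    intro v hv
    rw [hc v hv]
    exact b.coord_apply_eq ⟨v, hv⟩
  have h0 : ∀ v ∈ t, ∀ u ∈ t, u ≠ v → c v u = 0 := by
    intro v hv u hu huv
    rw [hc v hv]
    exact b.coord_apply_ne (i := ⟨v, hv⟩) (j := ⟨u, hu⟩) (by simpa using huv.symm)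
  refine ⟨t, c, hst, h1, h0, ?_⟩
  apply Subset.antisymm
  · apply convexHull_min
    · intro v hv
      have hv : v ∈ s := hv
      refine ⟨fun u hu => ?_, fun u hu hus => ?_⟩
      · by_cases h : v = u
        · subst h; rw [h1 v hu]; norm_num
        · rw [h0 u hu v (hst hv) h]
      · exact h0 u hu v (hst hv) (fun h => hus (h ▸ hv))
    · intro x hx y hy p q hp hq hpq
      refine ⟨fun v hv => ?_, fun v hv hvs => ?_⟩
      · rw [Convex.combo_affine_apply hpq, smul_eq_mul, smul_eq_mul]
        have := hx.1 v hv; have := hy.1 v hv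
        positivity
      · rw [Convex.combo_affine_apply hpq, hx.2 v hv hvs, hy.2 v hv hvs]
        simp
  · rintro y ⟨hy0, hyz⟩
    rw [Finset.mem_convexHull']
    have hsum1 := b.sum_coord_apply_eq_one y
    have hsum2 := b.linear_combination_coord_eq_self y
    have e1 : ∑ v ∈ t, c v y = 1 := by
      rw [← hsum1, ← Finset.sum_coe_sort t]
      exact Finset.sum_congr rfl fun v _ => by rw [hc v v.2]
    have e2 : ∑ v ∈ t, c v y • v = y := by
      conv_rhs => rw [← hsum2]
      rw [← Finset.sum_coe_sort t]
      exact Finset.sum_congr rfl fun v _ => by rw [hc v v.2, hb]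
    refine ⟨fun v => c v y, fun v hv => hy0 v (hst hv), ?_, ?_⟩
    · rw [← e1]
      exact Finset.sum_subset hst fun v hv hvs => hyz v hv hvs
    · conv_rhs => rw [← e2]
      exact Finset.sum_subset hst fun v hv hvs => by simp only [hyz v hv hvs, zero_smul]

/-- Near `x`, the set `X` is invariant under translations in direction `e`. -/
def IsFlatAt (X : Set (EuclideanSpace ℝ (Fin N))) (x e : EuclideanSpace ℝ (Fin N)) (ε : ℝ) :
    Prop :=
  ∀ y ∈ X, dist y x < ε → ∀ a : ℝ, dist (y + a • e) x < ε → y + a • e ∈ X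

theorem isClosed_simplex (s : Finset (EuclideanSpace ℝ (Fin N))) :
    IsClosed (convexHull ℝ (s : Set (EuclideanSpace ℝ (Fin N)))) :=
  (s.finite_toSet.isCompact_convexHull (𝕜 := ℝ)).isClosed

/-- By local finiteness and closedness, a small neighbourhood of x meets only simplices that contain
x. -/
theorem IsTriangulation.eventually_mem_simplex
    {T : Geometry.SimplicialComplex ℝ (EuclideanSpace ℝ (Fin N))}
    {X : Set (EuclideanSpace ℝ (Fin N))} (hT : IsTriangulation T X)
    (x : EuclideanSpace ℝ (Fin N)) :
    ∀ᶠ y in 𝓝 x, y ∈ X → ∃ r ∈ T.faces, x ∈ convexHull ℝ (r : Set (EuclideanSpace ℝ (Fin N))) ∧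
      y ∈ convexHull ℝ (r : Set (EuclideanSpace ℝ (Fin N))) := by
  filter_upwards [hT.1.eventually_subset (fun s => isClosed_simplex s.1) x] with y hy hyX
  rw [← hT.2, Geometry.SimplicialComplex.mem_space_iff] at hyX
  obtain ⟨r, hr, hyr⟩ := hyX
  exact ⟨r, hr, @hy ⟨r, hr⟩ hyr, hyr⟩

theorem IsTriangulation.isClosed
    {T : Geometry.SimplicialComplex ℝ (EuclideanSpace ℝ (Fin N))}
    {X : Set (EuclideanSpace ℝ (Fin N))} (hT : IsTriangulation T X) : IsClosed X := by
  have := hT.1.isClosed_iUnion (fun s => isClosed_simplex s.1)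
  rw [← hT.2]
  unfold Geometry.SimplicialComplex.space
  rwa [biUnion_eq_iUnion]

/-- A simplex s with the most vertices among those not inside K is a face of no larger simplex,
since any larger one would qualify too. A point of its interior lies in no other simplex, so there X
agrees locally with s, which is flat in the direction of an edge. -/
theorem IsTriangulation.exists_isFlatAt
    {T : Geometry.SimplicialComplex ℝ (EuclideanSpace ℝ (Fin N))}
    {X K : Set (EuclideanSpace ℝ (Fin N))} (hT : IsTriangulation T X) (hK : IsClosed K)
    (h : ∃ s ∈ T.faces, 2 ≤ s.card ∧ ¬ convexHull ℝ (s : Set (EuclideanSpace ℝ (Fin N))) ⊆ K) :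
    ∃ x ∈ X, ∃ e : EuclideanSpace ℝ (Fin N), ‖e‖ = 1 ∧ ∃ ε > 0,
      (∀ y ∈ K, ε ≤ dist y x) ∧ IsFlatAt X x e ε := by
  classical
  let P : Set ℕ := {n | ∃ s ∈ T.faces, 2 ≤ s.card ∧
    ¬ convexHull ℝ (s : Set (EuclideanSpace ℝ (Fin N))) ⊆ K ∧ s.card = n}
  have hPne : P.Nonempty := by
    obtain ⟨s, h1, h2, h3⟩ := h
    exact ⟨_, s, h1, h2, h3, rfl⟩
  have hPbdd : BddAbove P := by
    refine ⟨N + 1, ?_⟩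
    rintro n ⟨s, hs, -, -, rfl⟩
    have := (T.indep hs).card_le_finrank_succ
    rw [Fintype.card_coe] at this
    refine this.trans (Nat.succ_le_succ ?_)
    exact (Submodule.finrank_le _).trans (by simp)
  obtain ⟨s, hs, hs2, hsK, hscard⟩ := Nat.sSup_mem hPne hPbdd
  have hmax : ∀ r ∈ T.faces, s ⊆ r → r = s := by
    intro r hr hsr
    refine (Finset.eq_of_subset_of_card_le hsr ?_).symm
    rw [hscard]
    exact le_csSup hPbdd ⟨r, hr, hs2.trans (Finset.card_le_card hsr),
      fun hrK => hsK ((convexHull_mono (by exact_mod_cast hsr)).trans hrK), rfl⟩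
  obtain ⟨t, c, hst, h1, h0, hconv⟩ := exists_barycentric_coords (T.indep hs)
  have hcont : ∀ v, Continuous (c v) := fun v => (c v).continuous_of_finiteDimensional
  obtain ⟨z, hz, hzK⟩ := not_subset.1 hsK
  have hsne : s.Nonempty := Finset.card_pos.1 (by omega)
  have hw : ∑ _v ∈ s, (s.card : ℝ)⁻¹ = 1 := by
    rw [Finset.sum_const, nsmul_eq_mul, mul_inv_cancel₀]
    exact_mod_cast hsne.card_pos.ne'
  set g : EuclideanSpace ℝ (Fin N) := ∑ v ∈ s, (s.card : ℝ)⁻¹ • v with hg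
  have hgs : ∀ v ∈ s, 0 < c v g := by
    intro v hv
    have e : c v g = ∑ u ∈ s, (s.card : ℝ)⁻¹ * c v u := by
      have hdec : ∀ y, c v y = (c v).linear y + c v 0 := fun y => by
        have := congrFun (c v).decomp y
        simpa using this
      have h2 : ∑ u ∈ s, (s.card : ℝ)⁻¹ * c v u =
          ∑ u ∈ s, ((s.card : ℝ)⁻¹ * (c v).linear u + (s.card : ℝ)⁻¹ * c v 0) :=
        Finset.sum_congr rfl fun u _ => by rw [hdec u, mul_add]
      rw [h2, Finset.sum_add_distrib, ← Finset.sum_mul, hw, one_mul, hdec g, hg, map_sum]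
      simp only [map_smul, smul_eq_mul]
    rw [e, Finset.sum_eq_single_of_mem v hv fun u hu huv => by
      rw [h0 v (hst hv) u (hst hu) huv, mul_zero], h1 v (hst hv), mul_one]
    exact inv_pos.2 (by exact_mod_cast hsne.card_pos)
  have hgc : g ∈ convexHull ℝ (s : Set (EuclideanSpace ℝ (Fin N))) :=
    Finset.mem_convexHull'.2 ⟨fun _ => (s.card : ℝ)⁻¹, fun _ _ => by positivity, hw, rfl⟩
  -- a point of the open simplex off `K`
  obtain ⟨x, hxc, hxs, hxK⟩ : ∃ x ∈ convexHull ℝ (s : Set (EuclideanSpace ℝ (Fin N))),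
      (∀ v ∈ s, 0 < c v x) ∧ x ∉ K := by
    -- Move from z, off K, towards the barycentre g: a short move stays off the closed set K, and
    -- any move makes all coordinates positive.
    have hcl : Continuous (fun θ : ℝ => AffineMap.lineMap z g θ) := AffineMap.lineMap_continuous
    have hev : ∀ᶠ θ : ℝ in 𝓝 0, AffineMap.lineMap z g θ ∉ K :=
      hcl.continuousAt.eventually_mem (hK.isOpen_compl.mem_nhds (by simpa using hzK))
    obtain ⟨θ, ⟨hθ1, hθ2⟩⟩ := ((hev.filter_mono nhdsWithin_le_nhds).and
      (Ioo_mem_nhdsGT (show (0 : ℝ) < 1 by norm_num))).exists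
    have hxc : AffineMap.lineMap z g θ ∈ convexHull ℝ (s : Set (EuclideanSpace ℝ (Fin N))) :=
      (convex_convexHull ℝ _).lineMap_mem hz hgc ⟨hθ2.1.le, hθ2.2.le⟩
    refine ⟨_, hxc, fun v hv => ?_, hθ1⟩
    have hzv : 0 ≤ c v z := by
      rw [hconv] at hz
      exact hz.1 v (hst hv)
    rw [AffineMap.apply_lineMap, AffineMap.lineMap_apply_ring']
    have := hgs v hv
    nlinarith [hθ2.1, hθ2.2, mul_pos hθ2.1 this]
  have hface : ∀ r ∈ T.faces, x ∈ convexHull ℝ (r : Set (EuclideanSpace ℝ (Fin N))) → r = s := by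
    intro r hr hxr
    apply hmax r hr
    intro v hv
    by_contra hvr
    -- The point x would lie in the common face of s and r, where the coordinate of the missing
    -- vertex v vanishes.
    have hx' := T.inter_subset_convexHull hs hr ⟨hxc, hxr⟩
    have hsub : convexHull ℝ ((s : Set (EuclideanSpace ℝ (Fin N))) ∩ r) ⊆ {y | c v y = 0} := by
      apply convexHull_min
      · rintro u ⟨hu, hur⟩
        exact h0 v (hst hv) u (hst hu) (fun h => hvr (h ▸ hur))
      · intro x hx y hy p q _ _ hpq
        simp only [mem_ofPred_eq] at hx hy ⊢
        rw [Convex.combo_affine_apply hpq, hx, hy]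
        simp
    exact (hxs v hv).ne' (hsub hx')
  obtain ⟨v₀, hv₀, v₁, hv₁, hv⟩ := Finset.one_lt_card.1 hs2
  have hd : 0 < ‖v₁ - v₀‖ := norm_pos_iff.2 (sub_ne_zero.2 hv.symm)
  have hev : ∀ᶠ y in 𝓝 x, (y ∈ X → y ∈ convexHull ℝ (s : Set (EuclideanSpace ℝ (Fin N)))) ∧
      (∀ v ∈ s, 0 < c v y) ∧ y ∉ K := by
    refine ((hT.eventually_mem_simplex x).mono ?_).and (Filter.Eventually.and ?_
      (hK.isOpen_compl.mem_nhds hxK))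
    · intro y hy hyX
      obtain ⟨r, hr, hxr, hyr⟩ := hy hyX
      rwa [← hface r hr hxr]
    · rw [Filter.eventually_all_finset]
      intro v hv
      exact (hcont v).continuousAt.eventually (lt_mem_nhds (hxs v hv))
  obtain ⟨ε, hε, hball⟩ := Metric.eventually_nhds_iff.1 hev
  refine ⟨x, ?_, ‖v₁ - v₀‖⁻¹ • (v₁ - v₀), ?_, ε, hε, ?_, ?_⟩
  · rw [← hT.2]
    exact Geometry.SimplicialComplex.convexHull_subset_space hs hxc
  · rw [norm_smul, norm_inv, norm_norm, inv_mul_cancel₀ hd.ne']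
  · intro y hy
    by_contra hlt
    exact (hball (not_le.1 hlt)).2.2 hy
  · intro y hy hyx a hya
    have hys := (hball hyx).1 hy
    have hpos := (hball hya).2.1
    rw [← hT.2]
    apply Geometry.SimplicialComplex.convexHull_subset_space hs
    rw [hconv] at hys ⊢
    have hz : ∀ v ∈ t, v ∉ s → c v (y + a • ‖v₁ - v₀‖⁻¹ • (v₁ - v₀)) = 0 := by
      intro v hvt hvs
      have e1 : c v v₁ = 0 := h0 v hvt v₁ (hst hv₁) (fun h => hvs (h ▸ hv₁))
      have e0 : c v v₀ = 0 := h0 v hvt v₀ (hst hv₀) (fun h => hvs (h ▸ hv₀))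
      have e2 : (c v).linear (v₁ - v₀) = 0 := by
        have := (c v).linearMap_vsub v₁ v₀
        simp only [vsub_eq_sub, e1, e0, sub_zero] at this
        exact this
      have := (c v).map_vadd y (a • ‖v₁ - v₀‖⁻¹ • (v₁ - v₀))
      simp only [vadd_eq_add, map_smul, e2, smul_zero, zero_add, hys.2 v hvt hvs] at this
      rwa [add_comm]
    refine ⟨fun v hvt => ?_, hz⟩
    by_cases hvs : v ∈ s
    · exact (hpos v hvs).le
    · exact (hz v hvt hvs).ge

end Simplices

/-! ### Small inductive dimension at least one -/

section Dimension

theorem not_one_le_smallInductiveDimension {Y : Type*} [TopologicalSpace Y]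
    [DiscreteTopology Y] : ¬ 1 ≤ smallInductiveDimension Y := by
  rw [not_le]
  have : smallInductiveDimension Y < ((1 : ℕ) : WithBot ℕ∞) := by
    rw [smallInductiveDimension_lt_iff, hasSmallInductiveDimensionLT_one_iff]
    exact TopologicalSpace.isTopologicalBasis_of_isOpen_of_nhds (fun _ h => h.isOpen)
      fun a u ha _ => ⟨u, isClopen_discrete u, ha, subset_rfl⟩
  exact_mod_cast this

/-- In dimension less than one a clopen set would separate the ends of the segment, against
connectedness of the interval. -/
theorem one_le_smallInductiveDimension_of_segment {N : ℕ} {Y : Set (EuclideanSpace ℝ (Fin N))}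
    {a b : EuclideanSpace ℝ (Fin N)} (hab : a ≠ b) (h : segment ℝ a b ⊆ Y) :
    1 ≤ smallInductiveDimension Y := by
  by_contra hlt
  rw [not_le] at hlt
  have hlt' : smallInductiveDimension Y < ((1 : ℕ) : WithBot ℕ∞) := by exact_mod_cast hlt
  rw [smallInductiveDimension_lt_iff, hasSmallInductiveDimensionLT_one_iff] at hlt'
  let γ : unitInterval → Y := fun t => ⟨AffineMap.lineMap a b (t : ℝ),
    h (by rw [segment_eq_image_lineMap]; exact ⟨t, t.2, rfl⟩)⟩
  have hγ : Continuous γ := by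
    apply Continuous.subtype_mk
    exact AffineMap.lineMap_continuous.comp continuous_subtype_val
  have hne : γ 0 ≠ γ 1 := by
    intro h
    have := congrArg Subtype.val h
    simp [γ] at this
    exact hab this
  obtain ⟨U, hU, h0, h1⟩ := hlt'.exists_subset_of_mem_open
    (show γ 0 ∈ ({γ 1}ᶜ : Set Y) from hne) isOpen_compl_singleton
  have hU' : IsClopen (γ ⁻¹' U) := IsClopen.preimage hU hγ
  rcases isClopen_iff.1 hU' with h | h
  · exact (h ▸ (show (0 : unitInterval) ∈ γ ⁻¹' U from h0) : (0 : unitInterval) ∈ (∅ : Set _))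
  · exact h1 (show γ 1 ∈ U from (h ▸ mem_univ (1 : unitInterval) : (1 : unitInterval) ∈ γ ⁻¹' U))
      rfl

variable {N : ℕ} {T : Geometry.SimplicialComplex ℝ (EuclideanSpace ℝ (Fin N))}
  {X K : Set (EuclideanSpace ℝ (Fin N))}

/-- If every simplex with an edge lies in K, each point off K is an isolated vertex and `X \ K` is
discrete. Otherwise a flat point off K carries a short segment in `X \ K`. -/
theorem IsTriangulation.one_le_dim_diff_iff (hT : IsTriangulation T X) (hK : IsClosed K) :
    1 ≤ smallInductiveDimension ↥(X \ K) ↔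
      ∃ s ∈ T.faces, 2 ≤ s.card ∧ ¬ convexHull ℝ (s : Set (EuclideanSpace ℝ (Fin N))) ⊆ K := by
  constructor
  · contrapose!
    intro h
    suffices DiscreteTopology ↥(X \ K) from not_le.1 not_one_le_smallInductiveDimension
    rw [discreteTopology_iff_isOpen_singleton]
    rintro ⟨x, hxX, hxK⟩
    have hev := (continuous_subtype_val.tendsto (⟨x, hxX, hxK⟩ : ↥(X \ K))).eventually
      (hT.eventually_mem_simplex x)
    rw [isOpen_singleton_iff_nhds_eq_pure]
    refine le_antisymm ?_ (pure_le_nhds _)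
    rw [Filter.le_pure_iff]
    filter_upwards [hev] with y hy
    obtain ⟨r, hr, hxr, hyr⟩ := hy y.2.1
    have hcard : r.card = 1 := by
      have h1 := (Geometry.SimplicialComplex.nonempty_of_mem_faces hr).card_pos
      have h2 : ¬ 2 ≤ r.card := fun h2 => hxK (h r hr h2 hxr)
      omega
    obtain ⟨v, rfl⟩ := Finset.card_eq_one.1 hcard
    simp only [Finset.coe_singleton, convexHull_singleton, mem_singleton_iff] at hxr hyr
    exact Subtype.ext (hyr.trans hxr.symm)
  · intro h
    obtain ⟨x, hx, e, he, ε, hε, hKε, hflat⟩ := hT.exists_isFlatAt hK h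
    have key : ∀ θ ∈ Icc (0 : ℝ) 1, dist (x + (θ * (ε / 2)) • e) x < ε := by
      intro θ hθ
      rw [dist_self_add_left, norm_smul, he, mul_one, Real.norm_eq_abs, abs_of_nonneg]
      · nlinarith [hθ.1, hθ.2]
      · exact mul_nonneg hθ.1 (by positivity)
    apply one_le_smallInductiveDimension_of_segment (a := x) (b := x + (ε / 2) • e)
    · intro h
      have : (ε / 2) • e = 0 := by simpa using h
      rw [smul_eq_zero] at this
      rcases this with h | h
      · linarith
      · simp [h] at he
    · rw [segment_eq_image']
      rintro _ ⟨θ, hθ, rfl⟩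
      have := key θ hθ
      simp only [add_sub_cancel_left, smul_smul]
      exact ⟨hflat x hx (by simpa using hε) _ this, fun h => (hKε _ h).not_gt this⟩

theorem IsTriangulation.forall_compact_one_le_dim_iff (hT : IsTriangulation T X) :
    (∀ K ⊆ X, IsCompact K → 1 ≤ smallInductiveDimension ↥(X \ K)) ↔
      (oneSimplices T).Infinite := by
  classical
  constructor
  · intro h hfin
    let V : Finset (EuclideanSpace ℝ (Fin N)) := hfin.toFinset.biUnion id
    let S : Set (Finset (EuclideanSpace ℝ (Fin N))) := {s | s ∈ T.faces ∧ 2 ≤ s.card}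
    -- Every vertex of a simplex of positive dimension is an end of one of its edges, so finitely
    -- many edges leave finitely many such simplices; their union is a forbidden compact set.
    have hS : S.Finite := by
      refine V.powerset.finite_toSet.subset ?_
      rintro s ⟨hs, hs2⟩
      simp only [Finset.coe_powerset, mem_preimage, mem_powerset_iff, Finset.coe_subset]
      intro v hv
      obtain ⟨u, hu, huv⟩ := Finset.exists_mem_ne (s := s) (by omega) v
      refine Finset.mem_biUnion.2 ⟨{u, v}, ?_, by simp⟩
      rw [Set.Finite.mem_toFinset]
      exact ⟨T.down_closed hs (by simp [Finset.insert_subset_iff, hu, hv]) (by simp),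
        Finset.card_pair huv⟩
    have hK : IsCompact (⋃ s ∈ S, convexHull ℝ (s : Set (EuclideanSpace ℝ (Fin N)))) :=
      hS.isCompact_biUnion fun s _ => s.finite_toSet.isCompact_convexHull (𝕜 := ℝ)
    obtain ⟨s, hs, hs2, hsK⟩ := (hT.one_le_dim_diff_iff hK.isClosed).1 (h _ (by
      rw [← hT.2]
      exact iUnion₂_subset fun s hs =>
        Geometry.SimplicialComplex.convexHull_subset_space hs.1) hK)
    exact hsK (subset_biUnion_of_mem (u := fun s : Finset (EuclideanSpace ℝ (Fin N)) =>
      convexHull ℝ (s : Set (EuclideanSpace ℝ (Fin N)))) (show s ∈ S from ⟨hs, hs2⟩))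
  · intro h K hKX hK
    rw [hT.one_le_dim_diff_iff hK.isClosed]
    have hfin := hT.1.finite_nonempty_inter_compact hK
    obtain ⟨s, hs, hsn⟩ := h.exists_notMem_finite (hfin.image Subtype.val)
    refine ⟨s, hs.1, hs.2.ge, fun hsK => hsn ⟨⟨s, hs.1⟩, ?_, rfl⟩⟩
    have : (convexHull ℝ (s : Set (EuclideanSpace ℝ (Fin N)))).Nonempty := by
      rw [convexHull_nonempty_iff]
      exact Geometry.SimplicialComplex.nonempty_of_mem_faces hs.1
    obtain ⟨y, hy⟩ := this
    exact ⟨y, hy, hsK hy⟩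

end Dimension

/-! ### A strictly monotone size functional on compact sets -/

section PackingSize

variable {α β : Type*} [MetricSpace α] [MetricSpace β]

/-- The largest `r` for which `S` contains `k + 2` points at mutual distances at least `r`. -/
noncomputable def packRadius (k : ℕ) (S : Set α) : ℝ :=
  sSup {r | 0 ≤ r ∧ ∃ p : Fin (k + 2) → α, (∀ i, p i ∈ S) ∧ ∀ i j, i ≠ j → r ≤ dist (p i) (p j)}

/-- A metric invariant of bounded sets which is strictly monotone on compact sets. -/
noncomputable def packSize (S : Set α) : ℝ := ∑' k, (1 / 2 : ℝ) ^ k * packRadius k S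

theorem packRadius_nonneg (k : ℕ) (S : Set α) : 0 ≤ packRadius k S :=
  Real.sSup_nonneg fun _ hr => hr.1

theorem le_diam_of_packing {S : Set α} (hS : Bornology.IsBounded S) {k : ℕ} {r : ℝ}
    (hr : r ∈ {r | 0 ≤ r ∧ ∃ p : Fin (k + 2) → α, (∀ i, p i ∈ S) ∧
      ∀ i j, i ≠ j → r ≤ dist (p i) (p j)}) : r ≤ Metric.diam S := by
  obtain ⟨-, p, hp, hpr⟩ := hr
  exact (hpr 0 1 (by simp)).trans (Metric.dist_le_diam_of_mem hS (hp 0) (hp 1))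

theorem packRadius_le_diam {S : Set α} (hS : Bornology.IsBounded S) (k : ℕ) :
    packRadius k S ≤ Metric.diam S :=
  Real.sSup_le (fun _ hr => le_diam_of_packing hS hr) Metric.diam_nonneg

theorem le_packRadius {S : Set α} (hS : Bornology.IsBounded S) {k : ℕ} {r : ℝ} (hr : 0 ≤ r)
    (p : Fin (k + 2) → α) (hp : ∀ i, p i ∈ S) (hpr : ∀ i j, i ≠ j → r ≤ dist (p i) (p j)) :
    r ≤ packRadius k S :=
  le_csSup ⟨_, fun _ h => le_diam_of_packing hS h⟩ ⟨hr, p, hp, hpr⟩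

theorem summable_packSize {S : Set α} (hS : Bornology.IsBounded S) :
    Summable fun k => (1 / 2 : ℝ) ^ k * packRadius k S :=
  Summable.of_nonneg_of_le (fun k => mul_nonneg (by positivity) (packRadius_nonneg k S))
    (fun k => mul_le_mul_of_nonneg_left (packRadius_le_diam hS k) (by positivity))
    (summable_geometric_two.mul_right _)

/-- The map g carries an r-separated packing to an (r - ε) / K-separated one. The two constants
serve bi-Lipschitz comparison (ε = 0) and uniform approximation (K = 1). -/
theorem packRadius_le_of_dist_le {S : Set α} {S' : Set β} (hS' : Bornology.IsBounded S')
    {g : α → β} (hg : ∀ p ∈ S, g p ∈ S') {K ε : ℝ} (hK : 0 < K) (hε : 0 ≤ ε)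
    (h : ∀ p ∈ S, ∀ q ∈ S, dist p q ≤ K * dist (g p) (g q) + ε) (k : ℕ) :
    packRadius k S ≤ K * packRadius k S' + ε := by
  have hn := packRadius_nonneg k S'
  refine Real.sSup_le ?_ (by positivity)
  rintro r ⟨hr, p, hp, hpr⟩
  rcases le_total r ε with hrε | hrε
  · nlinarith [mul_nonneg hK.le hn]
  · have : (r - ε) / K ≤ packRadius k S' := by
      refine le_packRadius hS' (div_nonneg (by linarith) hK.le) (g ∘ p) (fun i => hg _ (hp i)) ?_
      intro i j hij
      rw [div_le_iff₀ hK]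
      have := (hpr i j hij).trans (h _ (hp i) _ (hp j))
      simp only [Function.comp]
      linarith
    rw [div_le_iff₀ hK] at this
    linarith

/-- The additive error enters each radius once and the weights sum to 2. -/
theorem packSize_le_of_dist_le {S : Set α} {S' : Set β} (hS : Bornology.IsBounded S)
    (hS' : Bornology.IsBounded S')
    {g : α → β} (hg : ∀ p ∈ S, g p ∈ S') {K ε : ℝ} (hK : 0 < K) (hε : 0 ≤ ε)
    (h : ∀ p ∈ S, ∀ q ∈ S, dist p q ≤ K * dist (g p) (g q) + ε) :
    packSize S ≤ K * packSize S' + 2 * ε := by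
  have h1 : K * packSize S' + 2 * ε =
      ∑' k, (K * ((1 / 2 : ℝ) ^ k * packRadius k S') + (1 / 2 : ℝ) ^ k * ε) := by
    rw [((summable_packSize hS').mul_left K).tsum_add (summable_geometric_two.mul_right ε),
      tsum_mul_left, tsum_mul_right, tsum_geometric_two]
    rfl
  rw [h1]
  refine (summable_packSize hS).tsum_le_tsum (fun k => ?_)
    (((summable_packSize hS').mul_left K).add (summable_geometric_two.mul_right ε))
  have := packRadius_le_of_dist_le hS' hg hK hε h k
  have h2 : (0 : ℝ) < (1 / 2) ^ k := by positivity
  nlinarith [mul_le_mul_of_nonneg_left this h2.le]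

theorem packRadius_mono {S S' : Set α} (hS' : Bornology.IsBounded S') (h : S ⊆ S') (k : ℕ) :
    packRadius k S ≤ packRadius k S' := by
  simpa using packRadius_le_of_dist_le hS' (g := id) h one_pos le_rfl (by simp) k

theorem packSize_mono {S S' : Set α} (hS' : Bornology.IsBounded S') (h : S ⊆ S') :
    packSize S ≤ packSize S' := by
  simpa using packSize_le_of_dist_le (hS'.subset h) hS' (g := id) h one_pos le_rfl (by simp)

theorem packSize_nonneg (S : Set α) : 0 ≤ packSize S :=
  tsum_nonneg fun k => mul_nonneg (by positivity) (packRadius_nonneg k S)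

/-- Pigeonhole: with m balls of radius η / 4 covering S, two of any m + 2 points share a ball. -/
theorem exists_packRadius_lt {S : Set α} (hS : TotallyBounded S) {η : ℝ} (hη : 0 < η) :
    ∃ k, packRadius k S < η := by
  obtain ⟨t, ht, hcov⟩ := Metric.totallyBounded_iff.1 hS (η / 4) (by positivity)
  refine ⟨ht.toFinset.card, lt_of_le_of_lt (Real.sSup_le ?_ (by positivity))
    (show η / 2 < η by linarith)⟩
  rintro r ⟨-, p, hp, hpr⟩
  have hc : ∀ i, ∃ y ∈ ht.toFinset, dist (p i) y < η / 4 := by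
    intro i
    have := hcov (hp i)
    simp only [mem_iUnion, Metric.mem_ball] at this
    obtain ⟨y, hy, hd⟩ := this
    exact ⟨y, by simpa using hy, hd⟩
  choose y hy hd using hc
  obtain ⟨i, -, j, -, hij, he⟩ := Finset.exists_ne_map_eq_of_card_lt_of_maps_to
    (s := Finset.univ) (t := ht.toFinset) (f := y) (by simp) (fun i _ => hy i)
  have h1 := hpr i j hij
  have h2 := dist_triangle_right (p i) (p j) (y i)
  have h3 := hd i
  have h4 := hd j
  rw [← he] at h4
  linarith

/-- Let η be the distance from z to S and k the least index with `packRadius k S < η`. Then S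
contains k + 1 points with separation as close to η as desired; adding z gives k + 2 points of S',
so `packRadius k S' ≥ η` and the k-th term strictly increases. -/
theorem packSize_lt {S S' : Set α} (hS' : Bornology.IsBounded S') (h : S ⊆ S')
    (hS : IsCompact S) (hne : S.Nonempty) {z : α} (hz : z ∈ S') (hzS : z ∉ S) :
    packSize S < packSize S' := by
  classical
  set η := Metric.infDist z S
  have hη : 0 < η := (hS.isClosed.notMem_iff_infDist_pos hne).1 hzS
  have hex := exists_packRadius_lt hS.totallyBounded hη
  set k := Nat.find hex
  have hk : packRadius k S < η := Nat.find_spec hex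
  have hkey : η ≤ packRadius k S' := by
    refine le_of_forall_lt fun r hr => ?_
    obtain ⟨r', hr1, hr2⟩ := exists_between (max_lt hr hη)
    have hr0 : 0 ≤ r' := (le_max_right _ _).trans hr1.le
    refine lt_of_lt_of_le ((le_max_left _ _).trans_lt hr1) ?_
    have hq : ∃ q : Fin (k + 1) → α, (∀ i, q i ∈ S) ∧ ∀ i j, i ≠ j → r' ≤ dist (q i) (q j) := by
      -- For k = 0 a single point is enough; otherwise minimality of k is applied at k - 1, whose
      -- packings have exactly k + 1 points.
      rcases Nat.eq_zero_or_pos k with h0 | hpos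
      · obtain ⟨s, hs⟩ := hne
        refine ⟨fun _ => s, fun _ => hs, fun i j hij => ?_⟩
        have : Subsingleton (Fin (k + 1)) := by rw [h0]; exact (inferInstance : Subsingleton (Fin 1))
        exact (hij (Subsingleton.elim _ _)).elim
      · obtain ⟨m, hm⟩ := Nat.exists_eq_succ_of_ne_zero hpos.ne'
        have hlt : r' < packRadius m S :=
          hr2.trans_le (not_lt.1 (Nat.find_min hex (m := m) (by omega)))
        obtain ⟨r'', ⟨-, q, hq, hqr⟩, hrr⟩ := exists_lt_of_lt_csSup
          (by
            obtain ⟨s, hs⟩ := hne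
            exact ⟨0, le_rfl, fun _ => s, fun _ => hs, fun _ _ _ => dist_nonneg⟩) hlt
        rw [hm]
        exact ⟨q, hq, fun i j hij => hrr.le.trans (hqr i j hij)⟩
    obtain ⟨q, hq, hqr⟩ := hq
    refine le_packRadius hS' hr0 (Fin.cons z q) (fun i => ?_) (fun i j hij => ?_)
    · refine Fin.cases ?_ (fun i => ?_) i
      · simpa using hz
      · simpa using h (hq i)
    · have hzq : ∀ i, r' ≤ dist z (q i) := fun i =>
        hr2.le.trans (Metric.infDist_le_dist_of_mem (hq i))
      revert hij
      refine Fin.cases ?_ (fun i => ?_) i <;> refine Fin.cases ?_ (fun j => ?_) j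
      · intro h; exact (h rfl).elim
      · intro _; simpa using hzq j
      · intro _; simpa [dist_comm] using hzq i
      · intro hij
        simpa using hqr i j (fun h => hij (h ▸ rfl))
  refine (summable_packSize (hS'.subset h)).tsum_lt_tsum (i := k) (fun i => ?_) ?_
    (summable_packSize hS')
  · exact mul_le_mul_of_nonneg_left (packRadius_mono hS' h i) (by positivity)
  · exact mul_lt_mul_of_pos_left (hk.trans_le hkey) (by positivity)

end PackingSize

/-! ### The tent function and the squeezing map -/

section Tent

/-- The tent on `[-ρ, ρ]` with apex over `c * ρ`, of height `ρ`. -/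
noncomputable def tent (c ρ b : ℝ) : ℝ := max 0 (min ((ρ + b) / (1 + c)) ((ρ - b) / (1 - c)))

theorem tent_nonneg (c ρ b : ℝ) : 0 ≤ tent c ρ b := le_max_left _ _

variable {c c' ρ b : ℝ}

theorem tent_pos_iff (hc : |c| < 1) : 0 < tent c ρ b ↔ |b| < ρ := by
  obtain ⟨h1, h2⟩ := abs_lt.1 hc
  have h3 : 0 < 1 + c := by linarith
  have h4 : 0 < 1 - c := by linarith
  unfold tent
  rw [lt_max_iff, lt_min_iff, div_pos_iff_of_pos_right h3, div_pos_iff_of_pos_right h4, abs_lt]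
  simp only [lt_irrefl, false_or]
  constructor <;> rintro ⟨_, _⟩ <;> constructor <;> linarith

theorem tent_eq_zero (hc : |c| < 1) (h : ρ ≤ |b|) : tent c ρ b = 0 :=
  le_antisymm (not_lt.1 fun h' => ((tent_pos_iff hc).1 h').not_ge h) (tent_nonneg _ _ _)

/-- Where the tent over c has height at least s > 0 is the interval [-ρ + (1 + c)s, ρ - (1 - c)s],
and translation by (c' - c)s carries it to the one for c'. Sliding each point in proportion to its
height thus preserves heights and can be undone by the same recipe. -/
theorem tent_shift (hc : |c| < 1) (hc' : |c'| < 1) :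
    tent c' ρ (b + (c' - c) * tent c ρ b) = tent c ρ b := by
  by_cases h : ρ ≤ |b|
  · rw [tent_eq_zero hc h, mul_zero, add_zero, tent_eq_zero hc' h]
  have hpos := (tent_pos_iff hc).2 (not_le.1 h)
  obtain ⟨h1, h2⟩ := abs_lt.1 hc
  obtain ⟨h1', h2'⟩ := abs_lt.1 hc'
  have h3 : 0 < 1 + c := by linarith
  have h4 : 0 < 1 - c := by linarith
  have h3' : 0 < 1 + c' := by linarith
  have h4' : 0 < 1 - c' := by linarith
  have heq : tent c ρ b = min ((ρ + b) / (1 + c)) ((ρ - b) / (1 - c)) := by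
    unfold tent at hpos ⊢
    rcases lt_max_iff.1 hpos with h | h
    · exact (lt_irrefl _ h).elim
    · exact max_eq_right h.le
  set s := tent c ρ b
  have hle1 : s * (1 + c) ≤ ρ + b := by
    rw [← le_div_iff₀ h3, heq]; exact min_le_left _ _
  have hle2 : s * (1 - c) ≤ ρ - b := by
    rw [← le_div_iff₀ h4, heq]; exact min_le_right _ _
  unfold tent
  have hmin : min ((ρ + (b + (c' - c) * s)) / (1 + c')) ((ρ - (b + (c' - c) * s)) / (1 - c')) =
      s := by
    apply le_antisymm
    · rcases min_choice ((ρ + b) / (1 + c)) ((ρ - b) / (1 - c)) with h | h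
      · refine (min_le_left _ _).trans ?_
        rw [h, eq_div_iff h3.ne'] at heq
        rw [div_le_iff₀ h3']
        nlinarith
      · refine (min_le_right _ _).trans ?_
        rw [h, eq_div_iff h4.ne'] at heq
        rw [div_le_iff₀ h4']
        nlinarith
    · apply le_min
      · rw [le_div_iff₀ h3']
        nlinarith
      · rw [le_div_iff₀ h4']
        nlinarith
  rw [hmin, max_eq_right hpos.le]

theorem tent_le (hc : |c| < 1) {R : ℝ} (hR : 0 ≤ R) (h : ρ ≤ R) : tent c ρ b ≤ R := by
  obtain ⟨h1, h2⟩ := abs_lt.1 hc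
  have h3 : 0 < 1 + c := by linarith
  have h4 : 0 < 1 - c := by linarith
  refine max_le hR ?_
  by_contra hlt
  rw [not_le, lt_min_iff, lt_div_iff₀ h3, lt_div_iff₀ h4] at hlt
  linarith [hlt.1, hlt.2]

/-- The steeper side of the tent has slope 1 / (1 - |c|). -/
theorem tent_lipschitz (hc : |c| < 1) (ρ' b' : ℝ) :
    |tent c ρ b - tent c ρ' b'| ≤ (|ρ - ρ'| + |b - b'|) / (1 - |c|) := by
  have h0 : 0 < 1 - |c| := by linarith
  obtain ⟨h1, h2⟩ := abs_lt.1 hc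
  have h5 : 1 - |c| ≤ 1 + c := by linarith [neg_abs_le c]
  have h6 : 1 - |c| ≤ 1 - c := by linarith [le_abs_self c]
  have hnn : 0 ≤ |ρ - ρ'| + |b - b'| := by positivity
  have e1 : |(ρ + b) / (1 + c) - (ρ' + b') / (1 + c)| ≤ (|ρ - ρ'| + |b - b'|) / (1 - |c|) := by
    rw [← sub_div, abs_div, abs_of_pos (h0.trans_le h5)]
    refine div_le_div₀ hnn ?_ h0 h5
    rw [show ρ + b - (ρ' + b') = (ρ - ρ') + (b - b') by ring]
    exact abs_add_le _ _
  have e2 : |(ρ - b) / (1 - c) - (ρ' - b') / (1 - c)| ≤ (|ρ - ρ'| + |b - b'|) / (1 - |c|) := by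
    rw [← sub_div, abs_div, abs_of_pos (h0.trans_le h6)]
    refine div_le_div₀ hnn ?_ h0 h6
    rw [show ρ - b - (ρ' - b') = (ρ - ρ') - (b - b') by ring]
    exact abs_sub _ _
  have e3 := abs_min_sub_min_le_max ((ρ + b) / (1 + c)) ((ρ - b) / (1 - c))
    ((ρ' + b') / (1 + c)) ((ρ' - b') / (1 - c))
  have e4 := abs_max_sub_max_le_max 0 (min ((ρ + b) / (1 + c)) ((ρ - b) / (1 - c)))
    0 (min ((ρ' + b') / (1 + c)) ((ρ' - b') / (1 - c)))
  refine e4.trans (max_le ?_ (e3.trans (max_le e1 e2)))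
  simp only [sub_self, abs_zero]
  positivity

/-- A homeomorphism of the line onto `(-1, 1)`. -/
noncomputable def squash (t : ℝ) : ℝ := t / (1 + |t|)

theorem abs_squash (t : ℝ) : |squash t| = |t| / (1 + |t|) := by
  have : 0 < 1 + |t| := by positivity
  rw [squash, abs_div, abs_of_pos this]

theorem abs_squash_lt (t : ℝ) : |squash t| < 1 := by
  have : 0 < 1 + |t| := by positivity
  rw [abs_squash, div_lt_one this]
  linarith

/-- This choice of `squash` turns the slope bound of the tent into 1 + |t|, so bounded parameters
correspond to bounded Lipschitz constants. -/
theorem one_sub_abs_squash (t : ℝ) : 1 - |squash t| = (1 + |t|)⁻¹ := by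
  have : 0 < 1 + |t| := by positivity
  rw [abs_squash]
  field_simp
  ring

theorem squash_lt_squash {s t : ℝ} (h : s < t) : squash s < squash t := by
  have h1 : 0 < 1 + |s| := by positivity
  have h2 : 0 < 1 + |t| := by positivity
  rw [squash, squash, div_lt_div_iff₀ h1 h2]
  rcases abs_cases s with ⟨e, _⟩ | ⟨e, _⟩ <;> rcases abs_cases t with ⟨e', _⟩ | ⟨e', _⟩ <;>
    rw [e, e'] <;> nlinarith

@[simp] theorem squash_zero : squash 0 = 0 := by simp [squash]

theorem continuous_squash : Continuous squash :=
  continuous_id.div (by fun_prop) fun t => by positivity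

theorem exists_squash_eq (hc : |c| < 1) : ∃ t, squash t = c := by
  have h : 0 < 1 - |c| := by linarith
  refine ⟨c / (1 - |c|), ?_⟩
  rw [squash, abs_div, abs_of_pos h]
  field_simp
  ring

theorem continuous_tent_squash {α : Type*} [TopologicalSpace α] {t ρ b : α → ℝ}
    (ht : Continuous t) (hρ : Continuous ρ) (hb : Continuous b) :
    Continuous fun a => tent (squash (t a)) (ρ a) (b a) := by
  have hs := continuous_squash.comp ht
  refine continuous_const.max (((hρ.add hb).div (continuous_const.add hs) fun a => ?_).min
    ((hρ.sub hb).div (continuous_const.sub hs) fun a => ?_))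
  · exact (by linarith [(abs_lt.1 (abs_squash_lt (t a))).1] : (0 : ℝ) < 1 + squash (t a)).ne'
  · exact (by linarith [(abs_lt.1 (abs_squash_lt (t a))).2] : (0 : ℝ) < 1 - squash (t a)).ne'

end Tent

/-! ### Families of flat balls -/

/-- A family of small balls centred on `X`, far from each other and off `A`, in each of which
`X` is invariant under translations in some direction. -/
structure FlatFamily {N : ℕ} (X A : Set (EuclideanSpace ℝ (Fin N))) (ι : Type) where
  /-- the centres -/
  x : ι → EuclideanSpace ℝ (Fin N)
  /-- the directions -/
  e : ι → EuclideanSpace ℝ (Fin N)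
  /-- the radii -/
  ε : ι → ℝ
  x_mem : ∀ i, x i ∈ X
  norm_e : ∀ i, ‖e i‖ = 1
  ε_pos : ∀ i, 0 < ε i
  ε_le : ∀ i, ε i ≤ 1 / 2
  summable_ε : Summable ε
  sep : ∀ i j, i ≠ j → 2 ≤ dist (x i) (x j)
  flat : ∀ i, IsFlatAt X (x i) (e i) (ε i)
  avoid : ∀ i, ∀ y ∈ A, ε i ≤ dist y (x i)

namespace FlatFamily

variable {N : ℕ} {X A : Set (EuclideanSpace ℝ (Fin N))} {ι : Type} (B : FlatFamily X A ι)

/-- The scale of the `k.2`-th cell of the `k.1`-th ball. -/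
noncomputable def scale (k : ι × ℕ) : ℝ := B.ε k.1 * (1 / 4) ^ k.2

/-- The centre of a cell. -/
noncomputable def ctr (k : ι × ℕ) : EuclideanSpace ℝ (Fin N) :=
  B.x k.1 + (B.scale k / 2) • B.e k.1

/-- The radius of a cell. -/
noncomputable def rad (k : ι × ℕ) : ℝ := B.scale k / 8

/-- The coordinate in the direction of the axis. -/
noncomputable def ax (k : ι × ℕ) (y : EuclideanSpace ℝ (Fin N)) : ℝ :=
  inner ℝ (B.e k.1) (y - B.ctr k)

/-- The polyhedral distance to the axis. -/
noncomputable def off (k : ι × ℕ) (y : EuclideanSpace ℝ (Fin N)) : ℝ :=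
  ∑ j, |(y - B.ctr k - B.ax k y • B.e k.1) j|

/-- The cells: double cones around pairwise disjoint intervals. -/
def cell (k : ι × ℕ) : Set (EuclideanSpace ℝ (Fin N)) := {y | |B.ax k y| < B.rad k - B.off k y}

/-- The tent function of a cell. -/
noncomputable def tentAt (k : ι × ℕ) (t : ℝ) (y : EuclideanSpace ℝ (Fin N)) : ℝ :=
  tent (squash t) (B.rad k - B.off k y) (B.ax k y)

/-- The displacement, along the axis, of the map which moves in each cell the point of
parameter `t` of the axis to the one of parameter `t'`. -/
noncomputable def disp (t t' : ι × ℕ → ℝ) (k : ι × ℕ) (y : EuclideanSpace ℝ (Fin N)) :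
    EuclideanSpace ℝ (Fin N) :=
  ((squash (t' k) - squash (t k)) * B.tentAt k (t k) y) • B.e k.1

/-- The map with displacement `disp` in each cell. -/
noncomputable def shift (t t' : ι × ℕ → ℝ) (y : EuclideanSpace ℝ (Fin N)) :
    EuclideanSpace ℝ (Fin N) :=
  y + ∑' k, B.disp t t' k y

/-! ### Geometry of the cells and bijectivity of the squeezing map -/

theorem scale_pos (k : ι × ℕ) : 0 < B.scale k := mul_pos (B.ε_pos _) (by positivity)

theorem scale_le (k : ι × ℕ) : B.scale k ≤ B.ε k.1 :=
  mul_le_of_le_one_right (B.ε_pos _).le (pow_le_one₀ (by norm_num) (by norm_num))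

theorem rad_pos (k : ι × ℕ) : 0 < B.rad k := by
  have := B.scale_pos k
  unfold rad
  positivity

theorem summable_rad : Summable B.rad := by
  have h := Summable.mul_of_nonneg B.summable_ε
    (summable_geometric_of_lt_one (r := (1 / 4 : ℝ)) (by norm_num) (by norm_num))
    (fun i => (B.ε_pos i).le) (fun n => by positivity)
  exact h.div_const 8

theorem continuous_ax (k : ι × ℕ) : Continuous (B.ax k) := by
  unfold ax
  fun_prop

theorem continuous_off (k : ι × ℕ) : Continuous (B.off k) := by
  have := B.continuous_ax k
  unfold off
  fun_prop

theorem off_nonneg (k : ι × ℕ) (y : EuclideanSpace ℝ (Fin N)) : 0 ≤ B.off k y :=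
  Finset.sum_nonneg fun _ _ => abs_nonneg _

theorem ax_add (k : ι × ℕ) (y : EuclideanSpace ℝ (Fin N)) (a : ℝ) :
    B.ax k (y + a • B.e k.1) = B.ax k y + a := by
  unfold ax
  rw [add_sub_right_comm, inner_add_right, real_inner_smul_right, real_inner_self_eq_norm_sq,
    B.norm_e]
  ring

theorem off_add (k : ι × ℕ) (y : EuclideanSpace ℝ (Fin N)) (a : ℝ) :
    B.off k (y + a • B.e k.1) = B.off k y := by
  unfold off
  have h : y + a • B.e k.1 - B.ctr k - (B.ax k y + a) • B.e k.1 =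
      y - B.ctr k - B.ax k y • B.e k.1 := by module
  rw [ax_add, h]

theorem norm_le_sum_abs (w : EuclideanSpace ℝ (Fin N)) : ‖w‖ ≤ ∑ j, |w j| := by
  rw [EuclideanSpace.norm_eq]
  apply Real.sqrt_le_iff.2 ⟨Finset.sum_nonneg fun _ _ => abs_nonneg _, ?_⟩
  simp only [Real.norm_eq_abs]
  exact Finset.sum_sq_le_sq_sum_of_nonneg fun _ _ => abs_nonneg _

/-- The ℓ¹ norm in `off` keeps the cells polyhedral; it dominates the Euclidean norm, so each cell
still lies in a round ball. -/
theorem dist_ctr_lt {k : ι × ℕ} {y : EuclideanSpace ℝ (Fin N)} (hy : y ∈ B.cell k) :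
    dist y (B.ctr k) < B.rad k := by
  have h1 := norm_le_sum_abs (y - B.ctr k - B.ax k y • B.e k.1)
  have h2 := norm_le_norm_sub_add (y - B.ctr k) (B.ax k y • B.e k.1)
  rw [norm_smul, B.norm_e, mul_one, Real.norm_eq_abs] at h2
  have h3 : |B.ax k y| < B.rad k - B.off k y := hy
  rw [dist_eq_norm]
  have : B.off k y = ∑ j, |(y - B.ctr k - B.ax k y • B.e k.1) j| := rfl
  linarith

theorem dist_ctr_x (k : ι × ℕ) : dist (B.ctr k) (B.x k.1) = B.scale k / 2 := by
  have := B.scale_pos k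
  rw [ctr, dist_self_add_left, norm_smul, B.norm_e, mul_one, Real.norm_of_nonneg (by positivity)]

theorem dist_x_lt {k : ι × ℕ} {y : EuclideanSpace ℝ (Fin N)} (hy : dist y (B.ctr k) ≤ B.rad k) :
    dist y (B.x k.1) < B.scale k := by
  have h1 := dist_triangle y (B.ctr k) (B.x k.1)
  rw [B.dist_ctr_x] at h1
  have h3 := B.scale_pos k
  unfold rad at hy
  linarith

theorem eq_of_dist_le {k l : ι × ℕ} {y : EuclideanSpace ℝ (Fin N)}
    (hk : dist y (B.ctr k) ≤ B.rad k) (hl : dist y (B.ctr l) ≤ B.rad l) : k = l := by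
  have hk' := B.dist_x_lt hk
  have hl' := B.dist_x_lt hl
  have hi : k.1 = l.1 := by
    by_contra h
    have := B.sep _ _ h
    have := dist_triangle_left (B.x k.1) (B.x l.1) y
    linarith [B.ε_le k.1, B.ε_le l.1, B.scale_le k, B.scale_le l]
  obtain ⟨i, n⟩ := k
  obtain ⟨j, m⟩ := l
  simp only at hi
  subst hi
  -- In one row the centres of cells n < m are at least (1/2 - 1/8) of the larger scale apart, while
  -- the radii add up to at most (1/8 + 1/32) of it.
  have key : ∀ n m, n < m → dist y (B.ctr (i, n)) ≤ B.rad (i, n) →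
      dist y (B.ctr (i, m)) ≤ B.rad (i, m) → False := by
    intro n m hnm h1 h2
    have h3 := dist_triangle_left (B.ctr (i, n)) (B.ctr (i, m)) y
    have h4 : B.scale (i, m) ≤ B.scale (i, n) / 4 := by
      unfold scale
      rw [mul_div_assoc]
      apply mul_le_mul_of_nonneg_left _ (B.ε_pos i).le
      calc (1 / 4 : ℝ) ^ m ≤ (1 / 4) ^ (n + 1) :=
            pow_le_pow_of_le_one (by norm_num) (by norm_num) hnm
        _ = _ := by ring
    have h5 := B.scale_pos (i, n)
    have h6 : dist (B.ctr (i, n)) (B.ctr (i, m)) = B.scale (i, n) / 2 - B.scale (i, m) / 2 := by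
      unfold ctr
      rw [dist_add_left, dist_eq_norm, ← sub_smul, norm_smul, B.norm_e, mul_one,
        Real.norm_of_nonneg (by linarith)]
    unfold rad at h1 h2
    linarith
  rcases lt_trichotomy n m with h | h | h
  · exact (key n m h hk hl).elim
  · rw [h]
  · exact (key m n h hl hk).elim

theorem eq_of_mem_cell {k l : ι × ℕ} {y : EuclideanSpace ℝ (Fin N)}
    (hk : y ∈ B.cell k) (hl : y ∈ B.cell l) : k = l :=
  B.eq_of_dist_le (B.dist_ctr_lt hk).le (B.dist_ctr_lt hl).le

theorem tentAt_eq_zero {k : ι × ℕ} (t : ℝ) {y : EuclideanSpace ℝ (Fin N)} (hy : y ∉ B.cell k) :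
    B.tentAt k t y = 0 :=
  tent_eq_zero (abs_squash_lt _) (not_lt.1 hy)

theorem disp_eq_zero (t t' : ι × ℕ → ℝ) {k : ι × ℕ} {y : EuclideanSpace ℝ (Fin N)}
    (hy : y ∉ B.cell k) : B.disp t t' k y = 0 := by
  rw [disp, B.tentAt_eq_zero _ hy, mul_zero, zero_smul]

theorem tsum_disp_of_mem (t t' : ι × ℕ → ℝ) {k : ι × ℕ} {y : EuclideanSpace ℝ (Fin N)}
    (hy : y ∈ B.cell k) : ∑' l, B.disp t t' l y = B.disp t t' k y :=
  tsum_eq_single k fun _ hl => B.disp_eq_zero t t' fun h => hl (B.eq_of_mem_cell h hy)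

theorem tsum_disp_of_forall_notMem (t t' : ι × ℕ → ℝ) {y : EuclideanSpace ℝ (Fin N)}
    (hy : ∀ k, y ∉ B.cell k) : ∑' l, B.disp t t' l y = 0 := by
  simp [fun k => B.disp_eq_zero t t' (hy k)]

theorem shift_of_mem (t t' : ι × ℕ → ℝ) {k : ι × ℕ} {y : EuclideanSpace ℝ (Fin N)}
    (hy : y ∈ B.cell k) : B.shift t t' y = y + B.disp t t' k y := by
  rw [shift, B.tsum_disp_of_mem t t' hy]

theorem shift_of_forall_notMem (t t' : ι × ℕ → ℝ) {y : EuclideanSpace ℝ (Fin N)}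
    (hy : ∀ k, y ∉ B.cell k) : B.shift t t' y = y := by
  rw [shift, B.tsum_disp_of_forall_notMem t t' hy, add_zero]

/-- The displacement is parallel to the axis and leaves `off` unchanged, so this is `tent_shift` on
each line parallel to the axis. -/
theorem tentAt_add_disp (t t' : ι × ℕ → ℝ) (k : ι × ℕ) (y : EuclideanSpace ℝ (Fin N)) :
    B.tentAt k (t' k) (y + B.disp t t' k y) = B.tentAt k (t k) y := by
  unfold disp
  rw [tentAt, B.off_add, B.ax_add]
  exact tent_shift (abs_squash_lt _) (abs_squash_lt _)

theorem add_disp_mem_cell (t t' : ι × ℕ → ℝ) {k : ι × ℕ} {y : EuclideanSpace ℝ (Fin N)}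
    (hy : y ∈ B.cell k) : y + B.disp t t' k y ∈ B.cell k := by
  have h : 0 < B.tentAt k (t' k) (y + B.disp t t' k y) := by
    rw [tentAt_add_disp]
    exact (tent_pos_iff (abs_squash_lt _)).2 hy
  exact (tent_pos_iff (abs_squash_lt _)).1 h

/-- The shift preserves heights and cells, so the return displacement is the exact negative. -/
theorem shift_shift (t t' : ι × ℕ → ℝ) (y : EuclideanSpace ℝ (Fin N)) :
    B.shift t' t (B.shift t t' y) = y := by
  by_cases h : ∃ k, y ∈ B.cell k
  · obtain ⟨k, hk⟩ := h
    rw [B.shift_of_mem t t' hk, B.shift_of_mem t' t (B.add_disp_mem_cell t t' hk)]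
    have e : B.disp t' t k (y + B.disp t t' k y) = -B.disp t t' k y := by
      rw [disp, B.tentAt_add_disp]
      unfold disp
      module
    rw [e]
    abel
  · push Not at h
    rw [B.shift_of_forall_notMem t t' h, B.shift_of_forall_notMem t' t h]

/-- A moved point stays in its cell, hence in the flat ball, and moves in the direction in which X
is invariant there. -/
theorem shift_mem (t t' : ι × ℕ → ℝ) {y : EuclideanSpace ℝ (Fin N)} (hy : y ∈ X) :
    B.shift t t' y ∈ X := by
  by_cases h : ∃ k, y ∈ B.cell k
  · obtain ⟨k, hk⟩ := h
    rw [B.shift_of_mem t t' hk]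
    exact B.flat k.1 y hy ((B.dist_x_lt (B.dist_ctr_lt hk).le).trans_le (B.scale_le k)) _
      ((B.dist_x_lt (B.dist_ctr_lt (B.add_disp_mem_cell t t' hk)).le).trans_le (B.scale_le k))
  · push Not at h
    rwa [B.shift_of_forall_notMem t t' h]

theorem shift_of_forall_dist (t t' : ι × ℕ → ℝ) {y : EuclideanSpace ℝ (Fin N)}
    (hy : ∀ i, B.ε i ≤ dist y (B.x i)) : B.shift t t' y = y :=
  B.shift_of_forall_notMem t t' fun k hk =>
    (hy k.1).not_gt ((B.dist_x_lt (B.dist_ctr_lt hk).le).trans_le (B.scale_le k))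

theorem shift_self (t : ι × ℕ → ℝ) (y : EuclideanSpace ℝ (Fin N)) : B.shift t t y = y := by
  simp [shift, disp]

/-- The k-th displacement is at most twice the radius of the cell, whatever the parameters; the
radii are summable, so the series converges uniformly. -/
theorem continuous_shift : Continuous fun p : (ι × ℕ → ℝ) × (ι × ℕ → ℝ) ×
    EuclideanSpace ℝ (Fin N) => B.shift p.1 p.2.1 p.2.2 := by
  unfold shift
  refine (continuous_snd.comp continuous_snd).add (continuous_tsum (u := fun k => 2 * B.rad k)
    (fun k => ?_) (B.summable_rad.mul_left 2) fun k p => ?_)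
  · unfold disp tentAt
    have h1 : Continuous fun p : (ι × ℕ → ℝ) × (ι × ℕ → ℝ) × EuclideanSpace ℝ (Fin N) => p.1 k :=
      (continuous_apply k).comp continuous_fst
    have h2 : Continuous fun p : (ι × ℕ → ℝ) × (ι × ℕ → ℝ) × EuclideanSpace ℝ (Fin N) =>
      p.2.1 k := (continuous_apply k).comp (continuous_fst.comp continuous_snd)
    have h3 := continuous_tent_squash h1
      (continuous_const (y := B.rad k) |>.sub ((B.continuous_off k).comp
        (continuous_snd.comp continuous_snd)))
      ((B.continuous_ax k).comp (continuous_snd.comp continuous_snd))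
    exact (((continuous_squash.comp h2).sub (continuous_squash.comp h1)).mul h3).smul
      continuous_const
  · unfold disp tentAt
    rw [norm_smul, B.norm_e, mul_one, norm_mul, Real.norm_eq_abs, Real.norm_eq_abs,
      abs_of_nonneg (tent_nonneg _ _ _)]
    apply mul_le_mul
    · refine (abs_sub _ _).trans ?_
      linarith [abs_squash_lt (p.2.1 k), abs_squash_lt (p.1 k)]
    · exact tent_le (abs_squash_lt _) (B.rad_pos k).le (by linarith [B.off_nonneg k p.2.2])
    · exact tent_nonneg _ _ _
    · norm_num

/-! ### Lipschitz estimates for the squeezing map -/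

theorem abs_ax_sub_le (k : ι × ℕ) (y z : EuclideanSpace ℝ (Fin N)) :
    |B.ax k y - B.ax k z| ≤ dist y z := by
  unfold ax
  rw [← inner_sub_right, sub_sub_sub_cancel_right]
  refine (abs_real_inner_le_norm _ _).trans ?_
  rw [B.norm_e, one_mul, dist_eq_norm]

theorem abs_off_sub_le (k : ι × ℕ) (y z : EuclideanSpace ℝ (Fin N)) :
    |B.off k y - B.off k z| ≤ N * (2 * dist y z) := by
  unfold off
  rw [← Finset.sum_sub_distrib]
  refine (Finset.abs_sum_le_sum_abs _ _).trans ?_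
  have : ∀ j ∈ (Finset.univ : Finset (Fin N)),
      |(|(y - B.ctr k - B.ax k y • B.e k.1) j| - |(z - B.ctr k - B.ax k z • B.e k.1) j|)| ≤
      2 * dist y z := by
    intro j _
    refine (abs_abs_sub_abs_le _ _).trans ?_
    rw [← PiLp.sub_apply, ← Real.norm_eq_abs]
    refine (PiLp.norm_apply_le _ j).trans ?_
    rw [show y - B.ctr k - B.ax k y • B.e k.1 - (z - B.ctr k - B.ax k z • B.e k.1) =
      (y - z) - (B.ax k y - B.ax k z) • B.e k.1 by module]
    refine (norm_sub_le _ _).trans ?_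
    rw [norm_smul, B.norm_e, mul_one, Real.norm_eq_abs, ← dist_eq_norm]
    linarith [B.abs_ax_sub_le k y z]
  refine (Finset.sum_le_sum this).trans ?_
  simp

/-- Only the source parameter t controls the slope of the tent, giving 1 + M; t' enters through a
difference of squashed values, at most 2. The factor 2N + 1 bounds the variation of `off` and `ax`
together. -/
theorem dist_disp_le {t t' : ι × ℕ → ℝ} {k : ι × ℕ} {M : ℝ} (hM : |t k| ≤ M)
    (y z : EuclideanSpace ℝ (Fin N)) :
    dist (B.disp t t' k y) (B.disp t t' k z) ≤ 2 * ((2 * N + 1) * (1 + M)) * dist y z := by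
  have hM0 : 0 ≤ M := (abs_nonneg _).trans hM
  unfold disp tentAt
  rw [dist_eq_norm, ← sub_smul, norm_smul, B.norm_e, mul_one, ← mul_sub, norm_mul,
    Real.norm_eq_abs, Real.norm_eq_abs, mul_assoc]
  apply mul_le_mul _ _ (abs_nonneg _) (by norm_num)
  · refine (abs_sub _ _).trans ?_
    linarith [abs_squash_lt (t k), abs_squash_lt (t' k)]
  · refine (tent_lipschitz (abs_squash_lt _) _ _).trans ?_
    rw [one_sub_abs_squash, div_inv_eq_mul]
    have h1 := B.abs_ax_sub_le k y z
    have h2 := B.abs_off_sub_le k y z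
    rw [sub_sub_sub_cancel_left, abs_sub_comm (B.off k z)]
    have h3 : |B.off k y - B.off k z| + |B.ax k y - B.ax k z| ≤ (2 * N + 1) * dist y z := by
      linarith
    calc _ ≤ ((2 * N + 1) * dist y z) * (1 + M) := by gcongr
      _ = _ := by ring

/-- Two points meet at most two cells. If the cells differ, each displacement is compared with its
value 0 at the other point, which costs the single-cell constant twice. -/
theorem dist_shift_le {t t' : ι × ℕ → ℝ} {M : ℝ} (hM0 : 0 ≤ M)
    {y z : EuclideanSpace ℝ (Fin N)} (hy : ∀ k, y ∈ B.cell k → |t k| ≤ M)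
    (hz : ∀ k, z ∈ B.cell k → |t k| ≤ M) :
    dist (B.shift t t' y) (B.shift t t' z) ≤
      (1 + 4 * ((2 * N + 1) * (1 + M))) * dist y z := by
  set C : ℝ := 2 * ((2 * N + 1) * (1 + M)) with hC
  have hC0 : 0 ≤ C := by positivity
  have hd := dist_nonneg (x := y) (y := z)
  suffices dist (∑' k, B.disp t t' k y) (∑' k, B.disp t t' k z) ≤ (C + C) * dist y z by
    refine (dist_add_add_le _ _ _ _).trans ?_
    calc _ ≤ dist y z + (C + C) * dist y z := by linarith
      _ = _ := by rw [hC]; ring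
  by_cases h1 : ∃ k, y ∈ B.cell k <;> by_cases h2 : ∃ l, z ∈ B.cell l
  · obtain ⟨k, hk⟩ := h1
    obtain ⟨l, hl⟩ := h2
    rw [B.tsum_disp_of_mem t t' hk, B.tsum_disp_of_mem t t' hl]
    have e1 := B.dist_disp_le (t' := t') (hy k hk) y z
    have e2 := B.dist_disp_le (t' := t') (hz l hl) y z
    by_cases hkl : k = l
    · subst hkl
      nlinarith
    · rw [B.disp_eq_zero t t' (k := k) (y := z)
        (fun h => hkl (B.eq_of_mem_cell h hl)), dist_zero_right] at e1
      rw [B.disp_eq_zero t t' (k := l) (y := y)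
        (fun h => hkl (B.eq_of_mem_cell hk h)), dist_zero_left] at e2
      refine (dist_le_norm_add_norm _ _).trans ?_
      linarith
  · obtain ⟨k, hk⟩ := h1
    push Not at h2
    have e1 := B.dist_disp_le (t' := t') (hy k hk) y z
    rw [B.disp_eq_zero t t' (h2 k)] at e1
    rw [B.tsum_disp_of_mem t t' hk, B.tsum_disp_of_forall_notMem t t' h2]
    nlinarith
  · obtain ⟨l, hl⟩ := h2
    push Not at h1
    have e1 := B.dist_disp_le (t' := t') (hz l hl) y z
    rw [B.disp_eq_zero t t' (h1 l)] at e1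
    rw [B.tsum_disp_of_mem t t' hl, B.tsum_disp_of_forall_notMem t t' h1]
    nlinarith
  · push Not at h1 h2
    rw [B.tsum_disp_of_forall_notMem t t' h1, B.tsum_disp_of_forall_notMem t t' h2, dist_self]
    positivity

/-- The squeezing homeomorphisms, as elements of `𝓗_A(X)`. -/
noncomputable def homeo (t : ι × ℕ → ℝ) : homeoRel X A :=
  ⟨{ toFun := fun y => ⟨B.shift 0 t y, B.shift_mem 0 t y.2⟩
     invFun := fun y => ⟨B.shift t 0 y, B.shift_mem t 0 y.2⟩
     left_inv := fun y => Subtype.ext (B.shift_shift 0 t y)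
     right_inv := fun y => Subtype.ext (B.shift_shift t 0 y)
     continuous_toFun := (B.continuous_shift.comp (continuous_const.prodMk
       (continuous_const.prodMk continuous_subtype_val))).subtype_mk _
     continuous_invFun := (B.continuous_shift.comp (continuous_const.prodMk
       (continuous_const.prodMk continuous_subtype_val))).subtype_mk _ },
    fun y hy => Subtype.ext (B.shift_of_forall_dist 0 t fun i => B.avoid i y hy)⟩

theorem coe_homeo_apply (t : ι × ℕ → ℝ) (y : X) :
    (((B.homeo t : X ≃ₜ X) y : X) : EuclideanSpace ℝ (Fin N)) = B.shift 0 t y := rfl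

theorem homeo_zero : B.homeo 0 = 1 := by
  apply Subtype.ext
  apply Homeomorph.ext
  intro y
  exact Subtype.ext (B.shift_self 0 y)

/-- A map into `𝓗_A(X)` of the form `p ↦ h p ∘ f p` is continuous if `f` is jointly
continuous. -/
theorem continuous_mul_of_continuous_uncurry [LocallyCompactSpace X] {P : Type*}
    [TopologicalSpace P] {h f : P → homeoRel X A} (hh : Continuous h)
    (hf : Continuous fun p : P × X => (f p.1 : X ≃ₜ X) p.2) :
    Continuous fun p => h p * f p := by
  refine Continuous.subtype_mk (continuous_induced_rng.2 ?_) _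
  have h1 : Continuous fun p => (⟨(h p : X ≃ₜ X), (h p : X ≃ₜ X).continuous⟩ : C(X, X)) :=
    continuous_induced_dom.comp (continuous_subtype_val.comp hh)
  have h2 : Continuous fun p => (⟨(f p : X ≃ₜ X), (f p : X ≃ₜ X).continuous⟩ : C(X, X)) :=
    (ContinuousMap.curry ⟨_, hf⟩).continuous
  exact ContinuousMap.continuous_comp'.comp (h2.prodMk h1)

theorem continuous_mul_homeo [LocallyCompactSpace X] {P : Type*} [TopologicalSpace P]
    {h : P → homeoRel X A} {t : P → ι × ℕ → ℝ} (hh : Continuous h) (ht : Continuous t) :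
    Continuous fun p => h p * B.homeo (t p) := by
  refine continuous_mul_of_continuous_uncurry hh (Continuous.subtype_mk
    (B.continuous_shift.comp (continuous_const.prodMk (Continuous.prodMk ?_ ?_))) _)
  · exact ht.comp continuous_fst
  · exact continuous_subtype_val.comp continuous_snd

/-- The inverse is itself an explicit shift, from t back to 0, so continuity of inversion in the
homeomorphism group is not needed. -/
theorem continuous_mul_homeo_inv [LocallyCompactSpace X] {P : Type*} [TopologicalSpace P]
    {h : P → homeoRel X A} {t : P → ι × ℕ → ℝ} (hh : Continuous h) (ht : Continuous t) :
    Continuous fun p => h p * (B.homeo (t p))⁻¹ := by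
  refine continuous_mul_of_continuous_uncurry hh (Continuous.subtype_mk
    (B.continuous_shift.comp (Continuous.prodMk ?_ (continuous_const.prodMk ?_))) _)
  · exact ht.comp continuous_fst
  · exact continuous_subtype_val.comp continuous_snd

end FlatFamily

/-! ### Piecewise linear functions and maps -/

section PiecewiseLinear

variable {N : ℕ} {V W : Type*} [AddCommGroup V] [Module ℝ V] [AddCommGroup W] [Module ℝ W]

/-- A function which is affine on each of finitely many (possibly unbounded) polyhedra
covering the space. -/
def IsPLFun (u : EuclideanSpace ℝ (Fin N) → V) : Prop :=
  ∃ (κ : Type) (_ : Finite κ) (G : κ → Set (EuclideanSpace ℝ (Fin N) →ᵃ[ℝ] ℝ))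
    (a : κ → EuclideanSpace ℝ (Fin N) →ᵃ[ℝ] V),
    (∀ i, (G i).Finite) ∧ (∀ y, ∃ i, ∀ g ∈ G i, 0 ≤ g y) ∧
    ∀ i y, (∀ g ∈ G i, 0 ≤ g y) → u y = a i y

theorem IsPLFun.of_affine (a : EuclideanSpace ℝ (Fin N) →ᵃ[ℝ] V) : IsPLFun fun y => a y :=
  ⟨Unit, inferInstance, fun _ => ∅, fun _ => a, fun _ => finite_empty,
    fun _ => ⟨(), fun _ h => h.elim⟩, fun _ _ _ => rfl⟩

theorem IsPLFun.congr {u v : EuclideanSpace ℝ (Fin N) → V} (hu : IsPLFun u)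
    (h : ∀ y, u y = v y) : IsPLFun v :=
  funext h ▸ hu

theorem IsPLFun.add {u v : EuclideanSpace ℝ (Fin N) → V} (hu : IsPLFun u) (hv : IsPLFun v) :
    IsPLFun fun y => u y + v y := by
  obtain ⟨κ, _, G, a, hG, hc, ha⟩ := hu
  obtain ⟨κ', _, G', a', hG', hc', ha'⟩ := hv
  refine ⟨κ × κ', inferInstance, fun i => G i.1 ∪ G' i.2, fun i => a i.1 + a' i.2,
    fun i => (hG _).union (hG' _), fun y => ?_, fun i y h => ?_⟩
  · obtain ⟨i, hi⟩ := hc y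
    obtain ⟨j, hj⟩ := hc' y
    exact ⟨(i, j), fun g hg => hg.elim (hi g) (hj g)⟩
  · simp [ha i.1 y fun g hg => h g (Or.inl hg), ha' i.2 y fun g hg => h g (Or.inr hg)]

theorem IsPLFun.linear_comp {u : EuclideanSpace ℝ (Fin N) → V} (hu : IsPLFun u) (L : V →ₗ[ℝ] W) :
    IsPLFun fun y => L (u y) := by
  obtain ⟨κ, hκ, G, a, hG, hc, ha⟩ := hu
  exact ⟨κ, hκ, G, fun i => L.toAffineMap.comp (a i), hG, hc, fun i y h => by simp [ha i y h]⟩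

theorem IsPLFun.const_mul {u : EuclideanSpace ℝ (Fin N) → ℝ} (hu : IsPLFun u) (c : ℝ) :
    IsPLFun fun y => c * u y :=
  hu.linear_comp (c • LinearMap.id)

theorem IsPLFun.neg {u : EuclideanSpace ℝ (Fin N) → V} (hu : IsPLFun u) :
    IsPLFun fun y => -u y :=
  hu.linear_comp (-LinearMap.id)

theorem IsPLFun.max {u v : EuclideanSpace ℝ (Fin N) → ℝ} (hu : IsPLFun u) (hv : IsPLFun v) :
    IsPLFun fun y => max (u y) (v y) := by
  obtain ⟨κ, _, G, a, hG, hc, ha⟩ := hu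
  obtain ⟨κ', _, G', a', hG', hc', ha'⟩ := hv
  refine ⟨κ × κ' × Bool, inferInstance,
    fun i => (G i.1 ∪ G' i.2.1) ∪ {bif i.2.2 then a i.1 - a' i.2.1 else a' i.2.1 - a i.1},
    fun i => bif i.2.2 then a i.1 else a' i.2.1,
    fun i => ((hG _).union (hG' _)).union (finite_singleton _), fun y => ?_, ?_⟩
  · obtain ⟨i, hi⟩ := hc y
    obtain ⟨j, hj⟩ := hc' y
    rcases le_total (a i y) (a' j y) with h | h
    · refine ⟨(i, j, false), fun g hg => hg.elim (fun hg => hg.elim (hi g) (hj g)) ?_⟩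
      rintro rfl
      simpa using h
    · refine ⟨(i, j, true), fun g hg => hg.elim (fun hg => hg.elim (hi g) (hj g)) ?_⟩
      rintro rfl
      simpa using h
  · rintro ⟨i, j, b⟩ y h
    have h1 := ha i y fun g hg => h g (Or.inl (Or.inl hg))
    have h2 := ha' j y fun g hg => h g (Or.inl (Or.inr hg))
    have h3 := h _ (Or.inr rfl)
    cases b
    · simp only [cond_false, AffineMap.coe_sub, Pi.sub_apply, sub_nonneg] at h3 ⊢
      rw [h1, h2, max_eq_right h3]
    · simp only [cond_true, AffineMap.coe_sub, Pi.sub_apply, sub_nonneg] at h3 ⊢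
      rw [h1, h2, max_eq_left h3]

theorem IsPLFun.min {u v : EuclideanSpace ℝ (Fin N) → ℝ} (hu : IsPLFun u) (hv : IsPLFun v) :
    IsPLFun fun y => min (u y) (v y) := by
  have := (hu.neg.max hv.neg).neg
  simpa [max_neg_neg] using this

theorem IsPLFun.abs {u : EuclideanSpace ℝ (Fin N) → ℝ} (hu : IsPLFun u) :
    IsPLFun fun y => |u y| :=
  hu.max hu.neg

theorem IsPLFun.sum {κ : Type*} {u : κ → EuclideanSpace ℝ (Fin N) → V} (s : Finset κ)
    (hu : ∀ i, IsPLFun (u i)) : IsPLFun fun y => ∑ i ∈ s, u i y := by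
  classical
  induction s using Finset.induction_on with
  | empty => simpa using IsPLFun.of_affine (AffineMap.const ℝ (EuclideanSpace ℝ (Fin N)) (0 : V))
  | insert i s hi ih => simpa [Finset.sum_insert hi] using (hu i).add ih

theorem isConvexCell_simplex {s : Finset (EuclideanSpace ℝ (Fin N))}
    (hs : AffineIndependent ℝ ((↑) : s → EuclideanSpace ℝ (Fin N))) :
    IsConvexCell (convexHull ℝ (s : Set (EuclideanSpace ℝ (Fin N)))) := by
  classical
  obtain ⟨t, c, -, -, -, hconv⟩ := exists_barycentric_coords hs
  refine ⟨s.finite_toSet.isCompact_convexHull (𝕜 := ℝ),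
    (c '' t) ∪ ((fun v => -c v) '' ((t \ s : Finset _) : Set (EuclideanSpace ℝ (Fin N)))),
    ((Finset.finite_toSet _).image _).union ((Finset.finite_toSet _).image _), ?_⟩
  rw [hconv]
  ext y
  simp only [mem_ofPred_eq]
  constructor
  · rintro ⟨h1, h2⟩ g (⟨v, hv, rfl⟩ | ⟨v, hv, rfl⟩)
    · exact h1 v hv
    · have hv : v ∈ t \ s := hv
      rw [Finset.mem_sdiff] at hv
      simp [h2 v hv.1 hv.2]
  · intro h
    refine ⟨fun v hv => h _ (Or.inl ⟨v, hv, rfl⟩), fun v hv hvs => ?_⟩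
    have h1 := h _ (Or.inl ⟨v, hv, rfl⟩)
    have h2 := h (-c v) (Or.inr ⟨v, by simp [hv, hvs], rfl⟩)
    simp only [AffineMap.coe_neg, Pi.neg_apply] at h2
    linarith

theorem IsConvexCell.inter_polyhedron {C : Set (EuclideanSpace ℝ (Fin N))} (hC : IsConvexCell C)
    {G : Set (EuclideanSpace ℝ (Fin N) →ᵃ[ℝ] ℝ)} (hG : G.Finite) :
    IsConvexCell (C ∩ {x | ∀ g ∈ G, 0 ≤ g x}) := by
  obtain ⟨hCc, G', hG', rfl⟩ := hC
  refine ⟨hCc.inter_right ?_, G' ∪ G, hG'.union hG, ?_⟩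
  · simp only [ofPred_forall]
    exact isClosed_iInter fun g => isClosed_iInter fun _ =>
      isClosed_le continuous_const g.continuous_of_finiteDimensional
  · ext x
    simp only [mem_inter_iff, mem_ofPred_eq]
    exact ⟨fun h g hg => hg.elim (h.1 g) (h.2 g),
      fun h => ⟨fun g hg => h g (Or.inl hg), fun g hg => h g (Or.inr hg)⟩⟩

variable {X : Set (EuclideanSpace ℝ (Fin N))}

/-- A continuous map which on each cell of a locally finite cover agrees with a piecewise linear
function is piecewise linear. -/
theorem isPLMap_of_isPLFun_on_cells {f : X → X} (hf : Continuous f)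
    {𝒞 : Set (Set (EuclideanSpace ℝ (Fin N)))} (hcell : ∀ C ∈ 𝒞, IsConvexCell C)
    (hlf : LocallyFinite (fun C : 𝒞 => (C : Set (EuclideanSpace ℝ (Fin N))))) (hcov : ⋃₀ 𝒞 = X)
    (h : ∀ C ∈ 𝒞, ∃ w : EuclideanSpace ℝ (Fin N) → EuclideanSpace ℝ (Fin N), IsPLFun w ∧
      ∀ x : X, (x : EuclideanSpace ℝ (Fin N)) ∈ C → (f x : EuclideanSpace ℝ (Fin N)) = w x) :
    IsPLMap f := by
  choose! w hw hfw using h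
  choose! κ hκ G a hG hc ha using hw
  let F : (Σ C : 𝒞, κ C.1) → Set (EuclideanSpace ℝ (Fin N)) := fun p =>
    (p.1 : Set (EuclideanSpace ℝ (Fin N))) ∩ {x | ∀ g ∈ G p.1 p.2, 0 ≤ g x}
  have hF : LocallyFinite F := by
    intro x
    obtain ⟨U, hU, hfin⟩ := hlf x
    refine ⟨U, hU, ?_⟩
    have : ∀ C : 𝒞, (Set.range fun i : κ C.1 => (⟨C, i⟩ : Σ C : 𝒞, κ C.1)).Finite := fun C => by
      have := hκ C.1 C.2
      exact finite_range _
    refine (hfin.biUnion fun C _ => this C).subset ?_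
    rintro ⟨C, i⟩ ⟨y, hy, hyU⟩
    exact mem_biUnion (show C ∈ _ from ⟨y, hy.1, hyU⟩) ⟨i, rfl⟩
  refine ⟨hf, range F, ?_, hF.on_range, ?_, ?_⟩
  · rintro _ ⟨⟨C, i⟩, rfl⟩
    exact (hcell C C.2).inter_polyhedron (hG C C.2 i)
  · rw [← hcov]
    ext x
    simp only [mem_sUnion, mem_range, exists_exists_eq_and]
    constructor
    · rintro ⟨⟨C, i⟩, hx⟩
      exact ⟨C, C.2, hx.1⟩
    · rintro ⟨C, hC, hx⟩
      obtain ⟨i, hi⟩ := hc C hC x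
      exact ⟨⟨⟨C, hC⟩, i⟩, hx, hi⟩
  · rintro _ ⟨⟨C, i⟩, rfl⟩
    exact ⟨a C i, fun x hx => by rw [hfw C C.2 x hx.1, ha C C.2 i x hx.2]⟩

/-- Cut each cell C of f by the preimages of the cells of g under the affine map of f on C. The
image of C is compact and meets finitely many cells of g, which keeps the refined cover locally
finite. -/
theorem IsPLMap.comp {g f : X → X} (hg : IsPLMap g) (hf : IsPLMap f) : IsPLMap (g ∘ f) := by
  obtain ⟨hgc, 𝒟, hD, hDlf, hDcov, hDa⟩ := hg
  obtain ⟨hfc, 𝒞, hC, hClf, hCcov, hCa⟩ := hf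
  choose! a ha using hCa
  choose! b hb using hDa
  have hac : ∀ C, Continuous (a C) := fun C => (a C).continuous_of_finiteDimensional
  have hCX : ∀ C ∈ 𝒞, ∀ x ∈ C, x ∈ X := fun C hC x hx => by
    rw [← hCcov]; exact mem_sUnion_of_mem hx hC
  let F : 𝒞 × 𝒟 → Set (EuclideanSpace ℝ (Fin N)) := fun p => p.1.1 ∩ a p.1.1 ⁻¹' p.2.1
  have hF : LocallyFinite F := by
    intro x
    obtain ⟨U, hU, hfin⟩ := hClf x
    refine ⟨U, hU, ?_⟩
    have : ∀ C : 𝒞, ({C} ×ˢ {D : 𝒟 | ((D : Set (EuclideanSpace ℝ (Fin N))) ∩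
        a C '' C).Nonempty}).Finite := fun C =>
      (finite_singleton C).prod (hDlf.finite_nonempty_inter_compact ((hC C C.2).1.image (hac C)))
    refine (hfin.biUnion fun C _ => this C).subset ?_
    rintro ⟨C, D⟩ ⟨y, hy, hyU⟩
    exact mem_biUnion (show C ∈ _ from ⟨y, hy.1, hyU⟩) ⟨rfl, a C y, hy.2, y, hy.1, rfl⟩
  refine ⟨hgc.comp hfc, range F, ?_, hF.on_range, ?_, ?_⟩
  · rintro _ ⟨⟨⟨C, hC'⟩, ⟨D, hD'⟩⟩, rfl⟩
    obtain ⟨-, G, hG, hDG⟩ := hD D hD'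
    have := (hC C hC').inter_polyhedron (hG.image fun g => g.comp (a C))
    convert! this using 2
    ext x
    simp [hDG]
  · rw [← hCcov]
    ext x
    simp only [mem_sUnion, mem_range, exists_exists_eq_and]
    constructor
    · rintro ⟨⟨C, D⟩, hx⟩
      exact ⟨C, C.2, hx.1⟩
    · rintro ⟨C, hC', hx⟩
      have h1 : (f ⟨x, hCX C hC' x hx⟩ : EuclideanSpace ℝ (Fin N)) ∈ ⋃₀ 𝒟 := by
        rw [hDcov]; exact Subtype.coe_prop _
      rw [ha C hC' _ hx] at h1
      obtain ⟨D, hD', hxD⟩ := h1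
      exact ⟨⟨⟨C, hC'⟩, ⟨D, hD'⟩⟩, hx, hxD⟩
  · rintro _ ⟨⟨⟨C, hC'⟩, ⟨D, hD'⟩⟩, rfl⟩
    refine ⟨(b D).comp (a C), fun x hx => ?_⟩
    have h1 := ha C hC' x hx.1
    have h2 := hb D hD' (f x) (by rw [h1]; exact hx.2)
    rw [Function.comp_apply, h2, h1]
    rfl

end PiecewiseLinear

/-! ### The members of the tuple are subgroups -/

section Subgroups

variable {N : ℕ} {X A : Set (EuclideanSpace ℝ (Fin N))} {g h : homeoRel X A}

theorem mul_mem_homeoLocLip (hg : g ∈ homeoLocLip X A) (hh : h ∈ homeoLocLip X A) :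
    g * h ∈ homeoLocLip X A :=
  ⟨hg.1.comp hh.1, hh.2.comp hg.2⟩

theorem mul_mem_homeoLip (hg : g ∈ homeoLip X A) (hh : h ∈ homeoLip X A) :
    g * h ∈ homeoLip X A := by
  obtain ⟨⟨K, hK⟩, K', hK'⟩ := hg
  obtain ⟨⟨L, hL⟩, L', hL'⟩ := hh
  exact ⟨⟨_, hK.comp hL⟩, _, hL'.comp hK'⟩

theorem mul_mem_homeoPL (hg : g ∈ homeoPL X A) (hh : h ∈ homeoPL X A) :
    g * h ∈ homeoPL X A :=
  ⟨hg.1.comp hh.1, hh.2.comp hg.2⟩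

theorem mul_mem_homeoCompactSupport (hg : g ∈ homeoCompactSupport X A)
    (hh : h ∈ homeoCompactSupport X A) : g * h ∈ homeoCompactSupport X A := by
  refine (IsCompact.union hg hh).of_isClosed_subset isClosed_closure ?_
  rw [← closure_union]
  refine closure_mono fun x hx => ?_
  by_contra hn
  simp only [mem_union, mem_ofPred_eq, not_or, not_not] at hn
  exact hx (show (g : X ≃ₜ X) ((h : X ≃ₜ X) x) = x by rw [hn.2, hn.1])

theorem inv_mem_homeoCompactSupport (hh : h ∈ homeoCompactSupport X A) :
    h⁻¹ ∈ homeoCompactSupport X A := by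
  refine IsCompact.of_isClosed_subset hh isClosed_closure (closure_mono fun x hx hn => hx ?_)
  exact (h : X ≃ₜ X).symm_apply_eq.2 hn.symm

theorem mul_mem_homeoTuple (i : Fin 6) (hg : g ∈ homeoTuple X A i) (hh : h ∈ homeoTuple X A i) :
    g * h ∈ homeoTuple X A i := by
  fin_cases i
  · trivial
  · exact mul_mem_homeoLocLip hg hh
  · exact mul_mem_homeoLip hg hh
  · exact ⟨mul_mem_homeoLip hg.1 hh.1, mul_mem_homeoCompactSupport hg.2 hh.2⟩
  · exact mul_mem_homeoPL hg hh
  · exact ⟨mul_mem_homeoPL hg.1 hh.1, mul_mem_homeoCompactSupport hg.2 hh.2⟩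

theorem inv_mem_homeoTuple (i : Fin 6) (hh : h ∈ homeoTuple X A i) :
    h⁻¹ ∈ homeoTuple X A i := by
  fin_cases i
  · trivial
  · exact ⟨hh.2, hh.1⟩
  · exact ⟨hh.2, hh.1⟩
  · exact ⟨⟨hh.1.2, hh.1.1⟩, inv_mem_homeoCompactSupport hh.2⟩
  · exact ⟨hh.2, hh.1⟩
  · exact ⟨⟨hh.1.2, hh.1.1⟩, inv_mem_homeoCompactSupport hh.2⟩

end Subgroups

/-! ### Subgroups containing the squeezing homeomorphisms -/

namespace FlatFamily

variable {N : ℕ} {X A : Set (EuclideanSpace ℝ (Fin N))} {ι : Type} (B : FlatFamily X A ι)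

theorem homeo_mem_homeoLip {t : ι × ℕ → ℝ} (ht : ∃ M, ∀ k, |t k| ≤ M) :
    B.homeo t ∈ homeoLip X A := by
  obtain ⟨M, hM⟩ := ht
  have hM' : ∀ k, |t k| ≤ |M| := fun k => (hM k).trans (le_abs_self M)
  refine ⟨⟨Real.toNNReal (1 + 4 * ((2 * N + 1) * (1 + |M|))), ?_⟩,
    ⟨Real.toNNReal (1 + 4 * ((2 * N + 1) * (1 + |M|))), ?_⟩⟩ <;>
  · refine LipschitzWith.of_dist_le_mul fun y z => ?_
    rw [Real.coe_toNNReal _ (by positivity)]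
    refine B.dist_shift_le (abs_nonneg M) (fun k _ => ?_) (fun k _ => ?_) <;>
    first
    | exact hM' k
    | simp

theorem subsingleton_ball_inter (y : EuclideanSpace ℝ (Fin N)) :
    {i | (Metric.closedBall (B.x i) (1 / 2) ∩ Metric.ball y (1 / 4)).Nonempty}.Subsingleton := by
  rintro i ⟨z, hz, hz'⟩ j ⟨w, hw, hw'⟩
  by_contra h
  have h1 := B.sep i j h
  rw [Metric.mem_closedBall] at hz hw
  rw [Metric.mem_ball] at hz' hw'
  have h2 := dist_triangle_left (B.x i) (B.x j) z
  have h3 := dist_triangle z w (B.x j)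
  have h4 := dist_triangle_right z w y
  linarith

theorem locallyFinite_closedBall : LocallyFinite fun i => Metric.closedBall (B.x i) (1 / 2) :=
  fun y => ⟨_, Metric.ball_mem_nhds y (by norm_num), (B.subsingleton_ball_inter y).finite⟩

theorem cell_subset_closedBall (k : ι × ℕ) : B.cell k ⊆ Metric.closedBall (B.x k.1) (1 / 2) :=
  fun _ hy => ((B.dist_x_lt (B.dist_ctr_lt hy).le).le.trans (B.scale_le k)).trans (B.ε_le k.1)

/-- A ball of radius 1/4 meets at most one of the balls of radius 1/2 about the flat points, so only
the bound of one row matters locally. -/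
theorem homeo_mem_homeoLocLip {t : ι × ℕ → ℝ} (ht : ∀ i, ∃ M, ∀ n, |t (i, n)| ≤ M) :
    B.homeo t ∈ homeoLocLip X A := by
  have key : ∀ y : EuclideanSpace ℝ (Fin N), ∃ M, 0 ≤ M ∧
      ∀ z ∈ Metric.ball y (1 / 4), ∀ k, z ∈ B.cell k → |t k| ≤ M := by
    intro y
    by_cases h : ∃ i, (Metric.closedBall (B.x i) (1 / 2) ∩ Metric.ball y (1 / 4)).Nonempty
    · obtain ⟨i, hi⟩ := h
      obtain ⟨M, hM⟩ := ht i
      refine ⟨M, (abs_nonneg _).trans (hM 0), fun z hz k hk => ?_⟩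
      obtain rfl := B.subsingleton_ball_inter y hi
        (show k.1 ∈ _ from ⟨z, B.cell_subset_closedBall k hk, hz⟩)
      exact hM k.2
    · exact ⟨0, le_rfl, fun z hz k hk => (h ⟨k.1, z, B.cell_subset_closedBall k hk, hz⟩).elim⟩
  constructor <;>
  · intro y
    obtain ⟨M, hM0, hM⟩ := key y
    refine ⟨Real.toNNReal (1 + 4 * ((2 * N + 1) * (1 + M))), Metric.ball y (1 / 4),
      Metric.ball_mem_nhds y (by norm_num), LipschitzOnWith.of_dist_le_mul fun u hu v hv => ?_⟩
    rw [Real.coe_toNNReal _ (by positivity)]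
    refine B.dist_shift_le hM0 (fun k hk => ?_) (fun k hk => ?_) <;>
    first
    | exact hM _ hu k hk
    | exact hM _ hv k hk
    | simpa using hM0

theorem homeo_mem_homeoCompactSupport (hX : IsClosed X) {t : ι × ℕ → ℝ}
    (ht : {i | ∃ n, t (i, n) ≠ 0}.Finite) : B.homeo t ∈ homeoCompactSupport X A := by
  have hc : IsCompact (⋃ i ∈ {i | ∃ n, t (i, n) ≠ 0}, Metric.closedBall (B.x i) (1 / 2)) :=
    ht.isCompact_biUnion fun i _ => isCompact_closedBall _ _
  refine (hX.isClosedEmbedding_subtypeVal.isCompact_preimage hc).of_isClosed_subset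
    isClosed_closure (closure_minimal ?_ (hc.isClosed.preimage continuous_subtype_val))
  intro y hy
  by_contra hn
  refine hy (Subtype.ext ?_)
  rw [coe_homeo_apply]
  by_cases h : ∃ k, (y : EuclideanSpace ℝ (Fin N)) ∈ B.cell k
  · obtain ⟨k, hk⟩ := h
    rw [B.shift_of_mem _ _ hk]
    have : t k = 0 := by
      by_contra h0
      exact hn (mem_biUnion (show k.1 ∈ {i | ∃ n, t (i, n) ≠ 0} from ⟨k.2, h0⟩)
        (B.cell_subset_closedBall k hk))
    simp [disp, this]
  · push Not at h
    exact B.shift_of_forall_notMem _ _ h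

theorem isPLFun_tentAt (k : ι × ℕ) (t : ℝ) : IsPLFun (B.tentAt k t) := by
  let L : EuclideanSpace ℝ (Fin N) →ᵃ[ℝ] EuclideanSpace ℝ (Fin N) :=
    AffineMap.id ℝ _ - AffineMap.const ℝ _ (B.ctr k)
  let axA : EuclideanSpace ℝ (Fin N) →ᵃ[ℝ] ℝ := (innerₗ _ (B.e k.1)).toAffineMap.comp L
  have hax : IsPLFun (B.ax k) := IsPLFun.of_affine axA
  have hoff : IsPLFun (B.off k) := by
    refine IsPLFun.sum _ fun j => IsPLFun.abs ?_
    let pj : EuclideanSpace ℝ (Fin N) →ₗ[ℝ] ℝ := (EuclideanSpace.proj j : _ →L[ℝ] ℝ).toLinearMap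
    exact ((IsPLFun.of_affine L).add
      (hax.linear_comp (LinearMap.toSpanSingleton ℝ _ (B.e k.1))).neg).linear_comp pj |>.congr
      fun y => by simp [pj, L, sub_eq_add_neg]
  have hrad : IsPLFun fun _ : EuclideanSpace ℝ (Fin N) => B.rad k :=
    IsPLFun.of_affine (AffineMap.const ℝ _ _)
  have hρ : IsPLFun fun y => B.rad k - B.off k y :=
    (hrad.add hoff.neg).congr fun y => (sub_eq_add_neg _ _).symm
  have h0 : IsPLFun fun _ : EuclideanSpace ℝ (Fin N) => (0 : ℝ) :=
    IsPLFun.of_affine (AffineMap.const ℝ _ _)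
  refine (h0.max (((hρ.add hax).const_mul (1 + squash t)⁻¹).min
    ((hρ.add hax.neg).const_mul (1 - squash t)⁻¹))).congr fun y => ?_
  simp only [tentAt, tent, div_eq_inv_mul, sub_eq_add_neg]

/-- A simplex is compact and meets finitely many flat balls, each with finitely many nonzero
parameters, so on it the displacement is a finite sum of PL functions. -/
theorem homeo_mem_homeoPL {T : Geometry.SimplicialComplex ℝ (EuclideanSpace ℝ (Fin N))}
    (hT : IsTriangulation T X) {t : ι × ℕ → ℝ} (ht : ∀ i, {n | t (i, n) ≠ 0}.Finite) :
    B.homeo t ∈ homeoPL X A := by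
  classical
  have hcell : ∀ C ∈ range (fun s : T.faces =>
      convexHull ℝ ((s : Finset (EuclideanSpace ℝ (Fin N))) : Set (EuclideanSpace ℝ (Fin N)))),
      IsConvexCell C := by
    rintro _ ⟨s, rfl⟩
    exact isConvexCell_simplex (T.indep s.2)
  have hcov : ⋃₀ range (fun s : T.faces =>
      convexHull ℝ ((s : Finset (EuclideanSpace ℝ (Fin N))) : Set (EuclideanSpace ℝ (Fin N)))) =
      X := by
    rw [← hT.2]
    unfold Geometry.SimplicialComplex.space
    rw [biUnion_eq_iUnion, sUnion_range]
  -- Stated for a general pair of parameters so as to cover both the map (0 to t) and its inverse (t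
  -- to 0).
  have key : ∀ s s' : ι × ℕ → ℝ, (∀ k, t k = 0 → s k = s' k) → ∀ K, IsCompact K →
      ∃ w : EuclideanSpace ℝ (Fin N) → EuclideanSpace ℝ (Fin N), IsPLFun w ∧
        ∀ y ∈ K, B.shift s s' y = w y := by
    intro s s' hs K hK
    have hfin := B.locallyFinite_closedBall.finite_nonempty_inter_compact hK
    have hfin2 : (⋃ i ∈ {i | (Metric.closedBall (B.x i) (1 / 2) ∩ K).Nonempty},
        Prod.mk i '' {n | t (i, n) ≠ 0}).Finite := hfin.biUnion fun i _ => (ht i).image _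
    refine ⟨fun y => y + ∑ k ∈ hfin2.toFinset, B.disp s s' k y, ?_, ?_⟩
    · refine (IsPLFun.of_affine (AffineMap.id ℝ _)).add (IsPLFun.sum _ fun k => ?_)
      exact ((B.isPLFun_tentAt k _).const_mul _).linear_comp
        (LinearMap.toSpanSingleton ℝ _ (B.e k.1))
    · intro y hy
      rw [shift]
      congr 1
      refine tsum_eq_sum fun k hk => ?_
      by_cases hkc : y ∈ B.cell k
      · have : t k = 0 := by
          by_contra h0
          refine hk (hfin2.mem_toFinset.2 (mem_biUnion (x := k.1) ?_ ⟨k.2, h0, rfl⟩))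
          exact ⟨y, B.cell_subset_closedBall k hkc, hy⟩
        simp [disp, hs k this]
      · exact B.disp_eq_zero _ _ hkc
  constructor
  · refine isPLMap_of_isPLFun_on_cells (Homeomorph.continuous _) hcell hT.1.on_range hcov ?_
    intro C hC
    obtain ⟨w, hw, h⟩ := key 0 t (fun k hk => hk.symm) C (hcell C hC).1
    exact ⟨w, hw, fun x hx => h x hx⟩
  · refine isPLMap_of_isPLFun_on_cells (Homeomorph.continuous _) hcell hT.1.on_range hcov ?_
    intro C hC
    obtain ⟨w, hw, h⟩ := key t 0 (fun k hk => hk) C (hcell C hC).1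
    exact ⟨w, hw, fun x hx => h x hx⟩

end FlatFamily

/-! ### The balance point of an arc -/

section Balance

variable {α β : Type*} [MetricSpace α] [MetricSpace β]

/-- A version of `packSize_le_of_dist_le` in which the comparison map acts on parameters; choosing a
parameter for each image point reduces it to that lemma. -/
theorem packSize_image_le {σ τ : Type*} {f : σ → α} {f' : τ → β} {I : Set σ} {J : Set τ}
    (hI : Bornology.IsBounded (f '' I)) (hJ : Bornology.IsBounded (f' '' J))
    {g : σ → τ} (hg : ∀ s ∈ I, g s ∈ J) {K ε : ℝ} (hK : 0 < K) (hε : 0 ≤ ε)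
    (h : ∀ s ∈ I, ∀ s' ∈ I, dist (f s) (f s') ≤ K * dist (f' (g s)) (f' (g s')) + ε) :
    packSize (f '' I) ≤ K * packSize (f' '' J) + 2 * ε := by
  have hc : ∀ p ∈ f '' I, ∃ s, s ∈ I ∧ f s = p := fun p hp => hp
  rcases I.eq_empty_or_nonempty with rfl | ⟨s₀, hs₀⟩
  · have := packSize_nonneg (f' '' J)
    -- If J is also empty there may be no map from α to β, so the comparison passes through ℝ; that
    -- the empty set has size 0 follows from comparing it with itself at K = 1/2.
    rcases J.eq_empty_or_nonempty with rfl | ⟨j, hj⟩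
    · have h1 := packSize_le_of_dist_le (S := (∅ : Set α)) (S' := (∅ : Set ℝ)) (g := fun _ => 0)
        (K := 1) (ε := 0) (by simp) (by simp) (by simp) one_pos le_rfl (by simp)
      have h2 : packSize (∅ : Set ℝ) = 0 := by
        have := packSize_le_of_dist_le (S := (∅ : Set ℝ)) (S' := (∅ : Set ℝ)) (g := fun _ => 0)
          (K := 1 / 2) (ε := 0) (by simp) (by simp) (by simp) (by norm_num) le_rfl (by simp)
        linarith [packSize_nonneg (∅ : Set ℝ)]
      simp only [image_empty] at *
      nlinarith
    · refine packSize_le_of_dist_le hI hJ (g := fun _ => f' j) ?_ hK hε ?_ <;> simp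
  · have : Nonempty σ := ⟨s₀⟩
    choose! i hi hfi using hc
    refine packSize_le_of_dist_le hI hJ (g := fun p => f' (g (i p))) ?_ hK hε ?_
    · exact fun p hp => ⟨_, hg _ (hi p hp), rfl⟩
    · intro p hp q hq
      have := h _ (hi p hp) _ (hi q hq)
      rwa [hfi p hp, hfi q hq] at this

/-- The difference of the sizes of the two subarcs of `φ '' [-1, 1]` determined by `φ c`. -/
noncomputable def imbalance (φ : ℝ → α) (c : ℝ) : ℝ :=
  packSize (φ '' Icc (-1) c) - packSize (φ '' Icc c 1)

variable {φ ψ : ℝ → α}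

theorem isBounded_image_Icc (hφ : Continuous φ) (a b : ℝ) : Bornology.IsBounded (φ '' Icc a b) :=
  (isCompact_Icc.image hφ).isBounded

theorem packSize_image_Icc_lt (hφ : Continuous φ) (hinj : InjOn φ (Icc (-1) 1)) {a b a' b' s : ℝ}
    (ha : -1 ≤ a') (haa : a' ≤ a) (hab : a ≤ b) (hbb : b ≤ b') (hb : b' ≤ 1)
    (hs : s ∈ Icc a' b') (hs' : s ∉ Icc a b) :
    packSize (φ '' Icc a b) < packSize (φ '' Icc a' b') := by
  refine packSize_lt (isBounded_image_Icc hφ _ _) (image_mono (Icc_subset_Icc haa hbb))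
    (isCompact_Icc.image hφ) ((nonempty_Icc.2 hab).image _) (mem_image_of_mem φ hs) ?_
  rintro ⟨s', hs1, hs2⟩
  have := hinj (Icc_subset_Icc (ha.trans haa) (hbb.trans hb) hs1) (Icc_subset_Icc ha hb hs) hs2
  exact hs' (this ▸ hs1)

/-- Moving the cut to the right strictly enlarges the left arc and does not enlarge the right one.
-/
theorem imbalance_strictMonoOn (hφ : Continuous φ) (hinj : InjOn φ (Icc (-1) 1)) :
    StrictMonoOn (imbalance φ) (Icc (-1) 1) := by
  intro c hc c' hc' hlt
  have h1 := packSize_image_Icc_lt hφ hinj le_rfl le_rfl hc.1 hlt.le hc'.2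
    (right_mem_Icc.2 hc'.1) (fun h => h.2.not_gt hlt)
  have h2 := packSize_mono (isBounded_image_Icc hφ c 1)
    (image_mono (f := φ) (Icc_subset_Icc_left (b := (1 : ℝ)) hlt.le))
  unfold imbalance
  linarith

theorem imbalance_neg_one (hφ : Continuous φ) (hinj : InjOn φ (Icc (-1) 1)) :
    imbalance φ (-1) < 0 := by
  have := packSize_image_Icc_lt (a := -1) (b := -1) (s := 1) hφ hinj le_rfl le_rfl le_rfl
    (by norm_num) le_rfl (by norm_num) (by norm_num)
  unfold imbalance
  linarith

theorem imbalance_one (hφ : Continuous φ) (hinj : InjOn φ (Icc (-1) 1)) :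
    0 < imbalance φ 1 := by
  have := packSize_image_Icc_lt (a := 1) (b := 1) (s := -1) hφ hinj le_rfl (by norm_num) le_rfl
    le_rfl le_rfl (by norm_num) (by norm_num)
  unfold imbalance
  linarith

/-- Displacing points by ε changes distances by 2ε, hence each size by 4ε, and there are two sizes.
-/
theorem abs_imbalance_sub_le (hφ : Continuous φ) (hψ : Continuous ψ) {ε : ℝ}
    (h : ∀ s ∈ Icc (-1 : ℝ) 1, dist (φ s) (ψ s) ≤ ε) {c : ℝ} (hc : c ∈ Icc (-1 : ℝ) 1) :
    |imbalance φ c - imbalance ψ c| ≤ 8 * ε := by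
  have hε : 0 ≤ ε := dist_nonneg.trans (h c hc)
  have key : ∀ {φ ψ : ℝ → α}, Continuous φ → Continuous ψ →
      (∀ s ∈ Icc (-1 : ℝ) 1, dist (φ s) (ψ s) ≤ ε) → ∀ a b : ℝ, -1 ≤ a → b ≤ 1 →
      packSize (φ '' Icc a b) ≤ packSize (ψ '' Icc a b) + 4 * ε := by
    intro φ ψ hφ hψ h a b ha hb
    have := packSize_image_le (isBounded_image_Icc hφ a b) (isBounded_image_Icc hψ a b) (g := id)
      (fun s hs => hs) one_pos (show 0 ≤ 2 * ε by positivity) (fun s hs s' hs' => by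
        have h1 := h s (Icc_subset_Icc ha hb hs)
        have h2 := h s' (Icc_subset_Icc ha hb hs')
        have h3 := dist_triangle4 (φ s) (ψ s) (ψ s') (φ s')
        rw [dist_comm (ψ s')] at h3
        simp only [id]
        linarith)
    linarith
  have h' : ∀ s ∈ Icc (-1 : ℝ) 1, dist (ψ s) (φ s) ≤ ε := fun s hs => by
    rw [dist_comm]; exact h s hs
  have e1 := key hφ hψ h (-1) c le_rfl hc.2
  have e2 := key hφ hψ h c 1 hc.1 le_rfl
  have e3 := key hψ hφ h' (-1) c le_rfl hc.2
  have e4 := key hψ hφ h' c 1 hc.1 le_rfl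
  unfold imbalance
  rw [abs_le]
  constructor <;> linarith

theorem continuousOn_imbalance (hφ : Continuous φ) : ContinuousOn (imbalance φ) (Icc (-1) 1) := by
  have huc := isCompact_Icc (a := (-1 : ℝ)) (b := 1) |>.uniformContinuousOn_of_continuous
    hφ.continuousOn
  rw [Metric.uniformContinuousOn_iff] at huc
  rw [Metric.continuousOn_iff]
  intro c hc ε hε
  obtain ⟨δ, hδ, h⟩ := huc (ε / 16) (by positivity)
  refine ⟨δ, hδ, fun c' hc' hcc => ?_⟩
  have key : ∀ {a b a' b' : ℝ}, a ∈ Icc (-1 : ℝ) 1 → b ∈ Icc (-1 : ℝ) 1 → a' ∈ Icc (-1 : ℝ) 1 →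
      b' ∈ Icc (-1 : ℝ) 1 → |a - a'| < δ → |b - b'| < δ → a ≤ b → a' ≤ b' →
      packSize (φ '' Icc a b) ≤ packSize (φ '' Icc a' b') + 4 * (ε / 16) := by
    intro a b a' b' ha hb ha' hb' haa hbb hab hab'
    rw [abs_lt] at haa hbb
    -- Clamping to [a', b'] moves parameters by less than δ, so uniform continuity of φ applies.
    have hg : ∀ s ∈ Icc a b, dist (φ s) (φ (max a' (min b' s))) ≤ ε / 16 := by
      intro s hs
      refine (h s ⟨ha.1.trans hs.1, hs.2.trans hb.2⟩ _ ⟨ha'.1.trans (le_max_left _ _),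
        max_le ha'.2 ((min_le_left _ _).trans hb'.2)⟩ ?_).le
      rw [Real.dist_eq, abs_lt]
      obtain ⟨hs1, hs2⟩ := hs
      rcases max_cases a' (min b' s) with ⟨e, _⟩ | ⟨e, _⟩ <;>
      rcases min_cases b' s with ⟨e', _⟩ | ⟨e', _⟩ <;> rw [e] <;> try rw [e']
      all_goals constructor <;> linarith
    have := packSize_image_le (isBounded_image_Icc hφ a b) (isBounded_image_Icc hφ a' b')
      (g := fun s => max a' (min b' s)) (fun s hs => ⟨le_max_left _ _, max_le hab' (min_le_left _ _)⟩)
      one_pos (show 0 ≤ 2 * (ε / 16) by positivity) (fun s hs s' hs' => by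
        have h1 := hg s hs
        have h2 := hg s' hs'
        have h3 := dist_triangle4 (φ s) (φ (max a' (min b' s))) (φ (max a' (min b' s'))) (φ s')
        rw [dist_comm (φ (max a' (min b' s')))] at h3
        linarith)
    linarith
  rw [Real.dist_eq] at hcc
  have hcc' : |c - c'| < δ := by rwa [abs_sub_comm]
  have hz : |(-1 : ℝ) - (-1)| < δ := by simpa using hδ
  have hz' : |(1 : ℝ) - 1| < δ := by simpa using hδ
  have m1 : (-1 : ℝ) ∈ Icc (-1 : ℝ) 1 := by norm_num
  have m2 : (1 : ℝ) ∈ Icc (-1 : ℝ) 1 := by norm_num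
  have e1 := key m1 hc m1 hc' hz hcc' hc.1 hc'.1
  have e2 := key m1 hc' m1 hc hz hcc hc'.1 hc.1
  have e3 := key hc m2 hc' m2 hcc' hz' hc.2 hc'.2
  have e4 := key hc' m2 hc m2 hcc hz' hc'.2 hc.2
  unfold imbalance
  rw [Real.dist_eq, abs_lt]
  constructor <;> linarith

theorem squash_mem_Icc (t : ℝ) : squash t ∈ Icc (-1 : ℝ) 1 :=
  abs_le.1 (abs_squash_lt t).le

/-- Intermediate value theorem; the strict signs at the ends keep the zero inside (-1, 1), the range
of `squash`. -/
theorem exists_imbalance_eq_zero (hφ : Continuous φ) (hinj : InjOn φ (Icc (-1) 1)) :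
    ∃ t, imbalance φ (squash t) = 0 := by
  have h1 := imbalance_neg_one hφ hinj
  have h2 := imbalance_one hφ hinj
  obtain ⟨c, hc, hc0⟩ := intermediate_value_Icc (by norm_num) (continuousOn_imbalance hφ)
    (show (0 : ℝ) ∈ Icc (imbalance φ (-1)) (imbalance φ 1) from ⟨h1.le, h2.le⟩)
  obtain ⟨t, rfl⟩ := exists_squash_eq (c := c) (by
    rw [abs_lt]
    constructor
    · refine lt_of_le_of_ne hc.1 ?_
      rintro rfl
      exact h1.ne hc0
    · refine lt_of_le_of_ne hc.2 ?_
      rintro rfl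
      exact h2.ne' hc0)
  exact ⟨t, hc0⟩

/-- The parameter of the balance point of an arc. -/
noncomputable def balancePt (φ : ℝ → α) : ℝ := Classical.epsilon fun t => imbalance φ (squash t) = 0

theorem imbalance_balancePt (hφ : Continuous φ) (hinj : InjOn φ (Icc (-1) 1)) :
    imbalance φ (squash (balancePt φ)) = 0 :=
  Classical.epsilon_spec (exists_imbalance_eq_zero hφ hinj)

theorem imbalance_squash_strictMono (hφ : Continuous φ) (hinj : InjOn φ (Icc (-1) 1)) :
    StrictMono fun t => imbalance φ (squash t) := fun _ _ h =>
  imbalance_strictMonoOn hφ hinj (squash_mem_Icc _) (squash_mem_Icc _) (squash_lt_squash h)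

theorem balancePt_eq_iff (hφ : Continuous φ) (hinj : InjOn φ (Icc (-1) 1)) {t : ℝ} :
    balancePt φ = t ↔ imbalance φ (squash t) = 0 := by
  rw [← (imbalance_squash_strictMono hφ hinj).injective.eq_iff, imbalance_balancePt hφ hinj]
  exact eq_comm

theorem balancePt_lt_iff (hφ : Continuous φ) (hinj : InjOn φ (Icc (-1) 1)) {t : ℝ} :
    balancePt φ < t ↔ 0 < imbalance φ (squash t) := by
  rw [← (imbalance_squash_strictMono hφ hinj).lt_iff_lt, imbalance_balancePt hφ hinj]

theorem lt_balancePt_iff (hφ : Continuous φ) (hinj : InjOn φ (Icc (-1) 1)) {t : ℝ} :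
    t < balancePt φ ↔ imbalance φ (squash t) < 0 := by
  rw [← (imbalance_squash_strictMono hφ hinj).lt_iff_lt, imbalance_balancePt hφ hinj]

/-- The translation s ↦ s + 1 induces an isometry between the two half arcs, which therefore have
equal size. -/
theorem balancePt_eq_zero (hφ : Continuous φ) (hinj : InjOn φ (Icc (-1) 1))
    (h : ∀ s ∈ Icc (-1 : ℝ) 0, ∀ s' ∈ Icc (-1 : ℝ) 0,
      dist (φ s) (φ s') = dist (φ (s + 1)) (φ (s' + 1))) : balancePt φ = 0 := by
  rw [balancePt_eq_iff hφ hinj, squash_zero]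
  have e1 := packSize_image_le (isBounded_image_Icc hφ (-1) 0) (isBounded_image_Icc hφ 0 1)
    (g := fun s => s + 1) (fun s hs => ⟨by linarith [hs.1], by linarith [hs.2]⟩) one_pos le_rfl
    (fun s hs s' hs' => by rw [h s hs s' hs', one_mul, add_zero])
  have e2 := packSize_image_le (isBounded_image_Icc hφ 0 1) (isBounded_image_Icc hφ (-1) 0)
    (g := fun s => s - 1) (fun s hs => ⟨by linarith [hs.1], by linarith [hs.2]⟩) one_pos le_rfl
    (fun s hs s' hs' => by
      rw [h (s - 1) ⟨by linarith [hs.1], by linarith [hs.2]⟩ (s' - 1)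
        ⟨by linarith [hs'.1], by linarith [hs'.2]⟩, one_mul, add_zero, sub_add_cancel,
        sub_add_cancel])
  unfold imbalance
  linarith

/-- Up to the scale δ the arc is K-bi-Lipschitz, so sizes of subarcs are proportional to parameter
lengths within a factor K². Equal sizes at the cut c force 1 + |c| ≤ K²(1 - |c|), and 1 - |c| = 1 /
(1 + |t|). -/
theorem abs_balancePt_le (hφ : Continuous φ) {K δ : ℝ} (hK : 0 < K) (hδ : 0 < δ)
    (h1 : ∀ s ∈ Icc (-1 : ℝ) 1, ∀ s' ∈ Icc (-1 : ℝ) 1, dist (φ s) (φ s') ≤ K * (δ * |s - s'|))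
    (h2 : ∀ s ∈ Icc (-1 : ℝ) 1, ∀ s' ∈ Icc (-1 : ℝ) 1, δ * |s - s'| ≤ K * dist (φ s) (φ s')) :
    |balancePt φ| ≤ K ^ 2 := by
  have hinj : InjOn φ (Icc (-1) 1) := by
    intro s hs s' hs' he
    have := h2 s hs s' hs'
    rw [he, dist_self, mul_zero] at this
    have h3 : |s - s'| ≤ 0 := by
      by_contra hlt
      exact this.not_gt (mul_pos hδ (not_le.1 hlt))
    exact sub_eq_zero.1 (abs_nonpos_iff.1 h3)
  have hb := imbalance_balancePt hφ hinj
  set t := balancePt φ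
  set c := squash t with hc
  have hc1 := abs_squash_lt t
  obtain ⟨hc2, hc3⟩ := abs_lt.1 hc1
  rw [← hc] at hc1 hc2 hc3
  have hp1 : 0 < 1 + c := by linarith
  have hp2 : 0 < 1 - c := by linarith
  -- The comparison map is the affine bijection of [a, b] onto [a', b'].
  have key : ∀ {a b a' b' : ℝ}, a < b → a' < b' → -1 ≤ a → b ≤ 1 → -1 ≤ a' → b' ≤ 1 →
      packSize (φ '' Icc a b) ≤ K ^ 2 * ((b - a) / (b' - a')) * packSize (φ '' Icc a' b') := by
    intro a b a' b' hab hab' ha hb ha' hb'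
    have q1 : 0 < b - a := by linarith
    have q2 : 0 < b' - a' := by linarith
    have hg : ∀ s ∈ Icc a b, a' + (s - a) * ((b' - a') / (b - a)) ∈ Icc a' b' := by
      intro s hs
      have r1 : 0 ≤ s - a := by linarith [hs.1]
      have r2 : (s - a) * ((b' - a') / (b - a)) ≤ b' - a' := by
        rw [mul_div_assoc', div_le_iff₀ q1]
        nlinarith [hs.2]
      have r3 : 0 ≤ (s - a) * ((b' - a') / (b - a)) := by positivity
      exact ⟨by linarith, by linarith⟩
    have := packSize_image_le (isBounded_image_Icc hφ a b) (isBounded_image_Icc hφ a' b')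
      (g := fun s => a' + (s - a) * ((b' - a') / (b - a))) hg
      (show 0 < K ^ 2 * ((b - a) / (b' - a')) by positivity) le_rfl (fun s hs s' hs' => by
        have r1 := h1 s (Icc_subset_Icc ha hb hs) s' (Icc_subset_Icc ha hb hs')
        have r2 := h2 _ (Icc_subset_Icc ha' hb' (hg s hs)) _ (Icc_subset_Icc ha' hb' (hg s' hs'))
        rw [show a' + (s - a) * ((b' - a') / (b - a)) - (a' + (s' - a) * ((b' - a') / (b - a))) =
          (s - s') * ((b' - a') / (b - a)) by ring, abs_mul,
          abs_of_pos (div_pos q2 q1)] at r2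
        have r3 := mul_le_mul_of_nonneg_left r2
          (show 0 ≤ K * ((b - a) / (b' - a')) by positivity)
        have r4 : K * ((b - a) / (b' - a')) * (δ * (|s - s'| * ((b' - a') / (b - a)))) =
          K * (δ * |s - s'|) := by
          field_simp
        rw [r4] at r3
        calc _ ≤ _ := r1.trans r3
          _ = _ := by ring)
    linarith
  have e1 := key hc2 hc3 le_rfl hc3.le hc2.le le_rfl
  have e2 := key hc3 hc2 hc2.le le_rfl le_rfl hc3.le
  have hpos : 0 < packSize (φ '' Icc (-1) c) := by
    refine (packSize_nonneg (φ '' Icc (-1) (-1))).trans_lt ?_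
    exact packSize_image_Icc_lt hφ hinj le_rfl le_rfl le_rfl hc2.le hc3.le
      (right_mem_Icc.2 hc2.le) (fun h => h.2.not_gt hc2)
  have heq : packSize (φ '' Icc c 1) = packSize (φ '' Icc (-1) c) := by
    unfold imbalance at hb
    linarith
  rw [heq] at e1 e2
  have f1 : 1 ≤ K ^ 2 * ((c - -1) / (1 - c)) := le_of_mul_le_mul_right (by linarith) hpos
  have f2 : 1 ≤ K ^ 2 * ((1 - c) / (c - -1)) := le_of_mul_le_mul_right (by linarith) hpos
  rw [mul_div_assoc', le_div_iff₀ hp2] at f1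
  rw [mul_div_assoc', le_div_iff₀ (by linarith)] at f2
  have hc4 : 1 + |c| ≤ K ^ 2 * (1 - |c|) := by
    rcases abs_cases c with ⟨e, _⟩ | ⟨e, _⟩ <;> rw [e] <;> linarith
  rw [one_sub_abs_squash, ← div_eq_mul_inv, le_div_iff₀ (by positivity)] at hc4
  nlinarith [abs_nonneg t, abs_nonneg c]

end Balance

/-! ### The balance parameters of a homeomorphism -/

namespace FlatFamily

variable {N : ℕ} {X A : Set (EuclideanSpace ℝ (Fin N))} {ι : Type} (B : FlatFamily X A ι)

/-- The affine parametrization of the axis of a cell by `[-1, 1]`. -/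
noncomputable def axis (k : ι × ℕ) (s : ℝ) : EuclideanSpace ℝ (Fin N) :=
  B.ctr k + (B.rad k * s) • B.e k.1

theorem axis_eq (k : ι × ℕ) (s : ℝ) :
    B.axis k s = B.x k.1 + (B.scale k * (1 / 2 + s / 8)) • B.e k.1 := by
  unfold axis ctr rad
  module

theorem dist_axis (k : ι × ℕ) (s s' : ℝ) :
    dist (B.axis k s) (B.axis k s') = B.rad k * |s - s'| := by
  unfold axis
  rw [dist_add_left, dist_eq_norm, ← sub_smul, norm_smul, B.norm_e, mul_one, ← mul_sub, norm_mul,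
    Real.norm_of_nonneg (B.rad_pos k).le, Real.norm_eq_abs]

theorem dist_axis_ctr_le (k : ι × ℕ) {s : ℝ} (hs : s ∈ Icc (-1 : ℝ) 1) :
    dist (B.axis k s) (B.ctr k) ≤ B.rad k := by
  have h := B.rad_pos k
  unfold axis
  rw [dist_self_add_left, norm_smul, B.norm_e, mul_one, norm_mul, Real.norm_of_nonneg h.le,
    Real.norm_eq_abs]
  exact mul_le_of_le_one_right h.le (abs_le.2 hs)

theorem dist_axis_x_lt (k : ι × ℕ) {s : ℝ} (hs : s ∈ Icc (-1 : ℝ) 1) :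
    dist (B.axis k s) (B.x k.1) < B.scale k :=
  B.dist_x_lt (B.dist_axis_ctr_le k hs)

theorem axis_mem (k : ι × ℕ) {s : ℝ} (hs : s ∈ Icc (-1 : ℝ) 1) : B.axis k s ∈ X := by
  have h := (B.dist_axis_x_lt k hs).trans_le (B.scale_le k)
  rw [axis_eq] at h ⊢
  exact B.flat k.1 _ (B.x_mem _) (by simpa using B.ε_pos k.1) _ h

/-- The parametrized axis, as a curve in `X` which is constant off `[-1, 1]`. -/
noncomputable def pt (k : ι × ℕ) (s : ℝ) : X :=
  ⟨B.axis k (projIcc (-1 : ℝ) 1 (by norm_num) s), B.axis_mem k (Subtype.coe_prop _)⟩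

theorem coe_pt (k : ι × ℕ) {s : ℝ} (hs : s ∈ Icc (-1 : ℝ) 1) :
    (B.pt k s : EuclideanSpace ℝ (Fin N)) = B.axis k s := by
  simp only [pt, projIcc_of_mem _ hs]

theorem continuous_pt (k : ι × ℕ) : Continuous (B.pt k) := by
  refine Continuous.subtype_mk ?_ _
  have : Continuous (B.axis k) := by unfold axis; fun_prop
  exact this.comp (continuous_subtype_val.comp continuous_projIcc)

theorem dist_pt (k : ι × ℕ) {s s' : ℝ} (hs : s ∈ Icc (-1 : ℝ) 1) (hs' : s' ∈ Icc (-1 : ℝ) 1) :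
    dist (B.pt k s) (B.pt k s') = B.rad k * |s - s'| := by
  rw [Subtype.dist_eq, B.coe_pt k hs, B.coe_pt k hs', dist_axis]

theorem injOn_pt (k : ι × ℕ) : InjOn (B.pt k) (Icc (-1) 1) := by
  intro s hs s' hs' h
  have h1 := B.dist_pt k hs hs'
  rw [h, dist_self, eq_comm, mul_eq_zero, abs_eq_zero, sub_eq_zero] at h1
  exact h1.resolve_left (B.rad_pos k).ne'

/-- The image of the axis of a cell under a homeomorphism. -/
noncomputable def arc (h : homeoRel X A) (k : ι × ℕ) (s : ℝ) : X := (h : X ≃ₜ X) (B.pt k s)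

theorem continuous_arc (h : homeoRel X A) (k : ι × ℕ) : Continuous (B.arc h k) :=
  (h : X ≃ₜ X).continuous.comp (B.continuous_pt k)

theorem injOn_arc (h : homeoRel X A) (k : ι × ℕ) : InjOn (B.arc h k) (Icc (-1) 1) :=
  (h : X ≃ₜ X).injective.comp_injOn (B.injOn_pt k)

/-- The parameters of the balance points of the images of the axes. -/
noncomputable def par (h : homeoRel X A) (k : ι × ℕ) : ℝ := balancePt (B.arc h k)

/-- Compact-open convergence is uniform on the compact axis, where `abs_imbalance_sub_le` applies.
-/
theorem continuous_imbalance_arc (k : ι × ℕ) {c : ℝ} (hc : c ∈ Icc (-1 : ℝ) 1) :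
    Continuous fun h : homeoRel X A => imbalance (B.arc h k) c := by
  rw [continuous_iff_continuousAt]
  intro h₀
  have h1 : Continuous fun h : homeoRel X A =>
      (⟨(h : X ≃ₜ X), (h : X ≃ₜ X).continuous⟩ : C(X, X)) :=
    (continuous_induced_dom (f := fun h : X ≃ₜ X => (⟨h, h.continuous⟩ : C(X, X)))).comp
      continuous_subtype_val
  have h2 := ContinuousMap.tendsto_iff_forall_isCompact_tendstoUniformlyOn.1 (h1.tendsto h₀)
    (B.pt k '' Icc (-1) 1) (isCompact_Icc.image (B.continuous_pt k))
  rw [Metric.tendstoUniformlyOn_iff] at h2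
  rw [ContinuousAt, Metric.tendsto_nhds]
  intro ε hε
  filter_upwards [h2 (ε / 16) (by positivity)] with h hh
  have := abs_imbalance_sub_le (B.continuous_arc h₀ k) (B.continuous_arc h k) (ε := ε / 16)
    (fun s hs => (hh _ (mem_image_of_mem _ hs)).le) hc
  rw [dist_comm, Real.dist_eq]
  linarith

/-- Whether the balance point lies left or right of t is the sign of the imbalance at t, an open
condition on h. -/
theorem continuous_par : Continuous (B.par : homeoRel X A → ι × ℕ → ℝ) := by
  refine continuous_pi fun k => continuous_iff_continuousAt.2 fun h₀ => ?_
  rw [ContinuousAt, tendsto_order]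
  constructor
  · intro t ht
    rw [par, lt_balancePt_iff (B.continuous_arc h₀ k) (B.injOn_arc h₀ k)] at ht
    filter_upwards [((B.continuous_imbalance_arc k (squash_mem_Icc t)).tendsto h₀).eventually
      (gt_mem_nhds ht)] with h hh
    exact (lt_balancePt_iff (B.continuous_arc h k) (B.injOn_arc h k)).2 hh
  · intro t ht
    rw [gt_iff_lt, par, balancePt_lt_iff (B.continuous_arc h₀ k) (B.injOn_arc h₀ k)] at ht
    filter_upwards [((B.continuous_imbalance_arc k (squash_mem_Icc t)).tendsto h₀).eventually
      (lt_mem_nhds ht)] with h hh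
    exact (balancePt_lt_iff (B.continuous_arc h k) (B.injOn_arc h k)).2 hh

theorem par_eq_zero {h : homeoRel X A} {k : ι × ℕ} {C : ℝ}
    (hC : ∀ s ∈ Icc (-1 : ℝ) 1, ∀ s' ∈ Icc (-1 : ℝ) 1,
      dist (B.arc h k s) (B.arc h k s') = C * |s - s'|) : B.par h k = 0 := by
  refine balancePt_eq_zero (B.continuous_arc h k) (B.injOn_arc h k) fun s hs s' hs' => ?_
  rw [hC s ⟨hs.1, by linarith [hs.2]⟩ s' ⟨hs'.1, by linarith [hs'.2]⟩,
    hC (s + 1) ⟨by linarith [hs.1], by linarith [hs.2]⟩ (s' + 1)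
      ⟨by linarith [hs'.1], by linarith [hs'.2]⟩, add_sub_add_right_eq_sub]

theorem par_eq_zero_of_fixed {h : homeoRel X A} {k : ι × ℕ}
    (hh : ∀ s, (h : X ≃ₜ X) (B.pt k s) = B.pt k s) : B.par h k = 0 := by
  refine B.par_eq_zero (C := B.rad k) fun s hs s' hs' => ?_
  simp only [arc, hh]
  exact B.dist_pt k hs hs'

theorem par_one : B.par (1 : homeoRel X A) = 0 :=
  funext fun _ => B.par_eq_zero_of_fixed fun _ => rfl

theorem ax_axis (k : ι × ℕ) (s : ℝ) : B.ax k (B.axis k s) = B.rad k * s := by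
  unfold ax axis
  rw [add_sub_cancel_left, real_inner_smul_right, real_inner_self_eq_norm_sq, B.norm_e]
  ring

theorem off_axis (k : ι × ℕ) (s : ℝ) : B.off k (B.axis k s) = 0 := by
  unfold off
  rw [ax_axis]
  unfold axis
  simp

theorem shift_axis (t : ι × ℕ → ℝ) (k : ι × ℕ) {s : ℝ} (hs : s ∈ Icc (-1 : ℝ) 1) :
    B.shift 0 t (B.axis k s) = B.axis k (s + squash (t k) * min (1 + s) (1 - s)) := by
  have hr := B.rad_pos k
  have hmin : 0 ≤ min (1 + s) (1 - s) := le_min (by linarith [hs.1]) (by linarith [hs.2])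
  by_cases h : B.axis k s ∈ B.cell k
  · have htent : B.tentAt k 0 (B.axis k s) = B.rad k * min (1 + s) (1 - s) := by
      unfold tentAt tent
      rw [off_axis, ax_axis, squash_zero, sub_zero, add_zero, sub_zero, div_one, div_one,
        mul_min_of_nonneg _ _ hr.le, max_eq_right]
      · congr 1 <;> ring
      · refine le_min ?_ ?_ <;> nlinarith [hs.1, hs.2]
    rw [B.shift_of_mem _ _ h, disp, Pi.zero_apply, htent, squash_zero]
    unfold axis
    module
  · rw [B.shift_of_forall_notMem]
    · have h1 : B.rad k ≤ |B.rad k * s| := by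
        have : ¬ |B.ax k (B.axis k s)| < B.rad k - B.off k (B.axis k s) := h
        rwa [ax_axis, off_axis, sub_zero, not_lt] at this
      rw [abs_mul, abs_of_pos hr, le_mul_iff_one_le_right hr] at h1
      -- An axis point outside its cell is an end of the axis, where the displacement in the formula
      -- vanishes.
      have h2 : min (1 + s) (1 - s) ≤ 0 := by
        rcases le_abs'.1 h1 with h1 | h1
        · exact (min_le_left _ _).trans (by linarith)
        · exact (min_le_right _ _).trans (by linarith)
      rw [le_antisymm h2 hmin, mul_zero, add_zero]
    · intro l hl
      exact h (B.eq_of_dist_le (B.dist_ctr_lt hl).le (B.dist_axis_ctr_le k hs) ▸ hl)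

theorem homeo_pt (t : ι × ℕ → ℝ) (k : ι × ℕ) {s : ℝ} (hs : s ∈ Icc (-1 : ℝ) 1) :
    (B.homeo t : X ≃ₜ X) (B.pt k s) = B.pt k (s + squash (t k) * min (1 + s) (1 - s)) := by
  obtain ⟨h1, h2⟩ := abs_lt.1 (abs_squash_lt (t k))
  have hm : s + squash (t k) * min (1 + s) (1 - s) ∈ Icc (-1 : ℝ) 1 := by
    have hmin : 0 ≤ min (1 + s) (1 - s) := le_min (by linarith [hs.1]) (by linarith [hs.2])
    have e1 := min_le_left (1 + s) (1 - s)
    have e2 := min_le_right (1 + s) (1 - s)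
    constructor <;> nlinarith
  apply Subtype.ext
  rw [coe_homeo_apply, B.coe_pt k hs, B.coe_pt k hm, B.shift_axis t k hs]

/-- On the axis the squeezing map is an increasing reparametrization fixing both ends and taking 0
to `squash (t k)`. Only the image set matters for `packSize`. -/
theorem arc_mul_homeo_image_left (h : homeoRel X A) (t : ι × ℕ → ℝ) (k : ι × ℕ) :
    B.arc (h * B.homeo t) k '' Icc (-1) 0 = B.arc h k '' Icc (-1) (squash (t k)) := by
  obtain ⟨h1, h2⟩ := abs_lt.1 (abs_squash_lt (t k))
  have key : ∀ s ∈ Icc (-1 : ℝ) 0, B.arc (h * B.homeo t) k s =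
      B.arc h k (s + squash (t k) * (1 + s)) := by
    intro s hs
    have := B.homeo_pt t k (s := s) ⟨hs.1, hs.2.trans zero_le_one⟩
    rw [min_eq_left (by linarith [hs.2])] at this
    change (h : X ≃ₜ X) ((B.homeo t : X ≃ₜ X) (B.pt k s)) = _
    rw [this]
    rfl
  apply Subset.antisymm
  · rintro _ ⟨s, hs, rfl⟩
    refine ⟨_, ⟨?_, ?_⟩, (key s hs).symm⟩ <;> nlinarith [hs.1, hs.2]
  · rintro _ ⟨u, hu, rfl⟩
    have hp : 0 < 1 + squash (t k) := by linarith
    have hm : (u - squash (t k)) / (1 + squash (t k)) ∈ Icc (-1 : ℝ) 0 :=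
      ⟨by rw [le_div_iff₀ hp]; linarith [hu.1], by rw [div_le_iff₀ hp]; linarith [hu.2]⟩
    refine ⟨_, hm, ?_⟩
    rw [key _ hm]
    congr 1
    field_simp
    ring

theorem arc_mul_homeo_image_right (h : homeoRel X A) (t : ι × ℕ → ℝ) (k : ι × ℕ) :
    B.arc (h * B.homeo t) k '' Icc 0 1 = B.arc h k '' Icc (squash (t k)) 1 := by
  obtain ⟨h1, h2⟩ := abs_lt.1 (abs_squash_lt (t k))
  have key : ∀ s ∈ Icc (0 : ℝ) 1, B.arc (h * B.homeo t) k s =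
      B.arc h k (s + squash (t k) * (1 - s)) := by
    intro s hs
    have := B.homeo_pt t k (s := s) ⟨by linarith [hs.1], hs.2⟩
    rw [min_eq_right (by linarith [hs.1])] at this
    change (h : X ≃ₜ X) ((B.homeo t : X ≃ₜ X) (B.pt k s)) = _
    rw [this]
    rfl
  apply Subset.antisymm
  · rintro _ ⟨s, hs, rfl⟩
    refine ⟨_, ⟨?_, ?_⟩, (key s hs).symm⟩ <;> nlinarith [hs.1, hs.2]
  · rintro _ ⟨u, hu, rfl⟩
    have hp : 0 < 1 - squash (t k) := by linarith
    have hm : (u - squash (t k)) / (1 - squash (t k)) ∈ Icc (0 : ℝ) 1 :=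
      ⟨div_nonneg (by linarith [hu.1]) hp.le, by rw [div_le_iff₀ hp]; linarith [hu.2]⟩
    refine ⟨_, hm, ?_⟩
    rw [key _ hm]
    congr 1
    field_simp
    ring

/-- The two halves of the new arc are, as sets, the two pieces of the old arc cut at `squash (t k)`.
This equivalence yields the product decomposition over the slice. -/
theorem par_mul_homeo_eq_zero_iff (h : homeoRel X A) (t : ι × ℕ → ℝ) :
    B.par (h * B.homeo t) = 0 ↔ B.par h = t := by
  rw [funext_iff, funext_iff]
  refine forall_congr' fun k => ?_
  rw [Pi.zero_apply, par, par, balancePt_eq_iff (B.continuous_arc _ k) (B.injOn_arc _ k),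
    balancePt_eq_iff (B.continuous_arc _ k) (B.injOn_arc _ k), squash_zero, imbalance, imbalance,
    arc_mul_homeo_image_left, arc_mul_homeo_image_right]

/-! ### Balance parameters of elements of the subgroups -/

theorem abs_par_le {h : homeoRel X A} {k : ι × ℕ} {K : ℝ} (hK : 0 < K)
    (h1 : ∀ s s', dist (B.arc h k s) (B.arc h k s') ≤ K * dist (B.pt k s) (B.pt k s'))
    (h2 : ∀ s s', dist (B.pt k s) (B.pt k s') ≤ K * dist (B.arc h k s) (B.arc h k s')) :
    |B.par h k| ≤ K ^ 2 := by
  refine abs_balancePt_le (B.continuous_arc h k) hK (B.rad_pos k) (fun s hs s' hs' => ?_)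
    fun s hs s' hs' => ?_
  · rw [← B.dist_pt k hs hs']; exact h1 s s'
  · rw [← B.dist_pt k hs hs']; exact h2 s s'

theorem bounded_par_of_mem_homeoLip {h : homeoRel X A} (hh : h ∈ homeoLip X A) :
    ∃ M, ∀ k, |B.par h k| ≤ M := by
  obtain ⟨⟨K, hK⟩, L, hL⟩ := hh
  refine ⟨((K : ℝ) + L + 1) ^ 2, fun k => B.abs_par_le (by positivity) (fun s s' => ?_)
    fun s s' => ?_⟩
  · refine (hK.dist_le_mul _ _).trans ?_
    gcongr
    linarith [L.coe_nonneg]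
  · have := hL.dist_le_mul (B.arc h k s) (B.arc h k s')
    simp only [arc, Homeomorph.symm_apply_apply] at this
    refine this.trans ?_
    unfold arc
    gcongr
    linarith [K.coe_nonneg]

theorem tendsto_scale (i : ι) : Filter.Tendsto (fun n => B.scale (i, n)) Filter.atTop (𝓝 0) := by
  unfold scale
  simpa using (tendsto_pow_atTop_nhds_zero_of_lt_one (r := (1 / 4 : ℝ)) (by norm_num)
    (by norm_num)).const_mul (B.ε i)

theorem dist_pt_x_lt (k : ι × ℕ) (s : ℝ) :
    dist (B.pt k s) ⟨B.x k.1, B.x_mem k.1⟩ < B.scale k :=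
  B.dist_axis_x_lt k (Subtype.coe_prop _)

/-- The axes of a row shrink to the flat point, so all but finitely many lie where h is bi-Lipschitz
with fixed constants; the finitely many others are absorbed by a sum. -/
theorem bounded_par_of_mem_homeoLocLip {h : homeoRel X A} (hh : h ∈ homeoLocLip X A) (i : ι) :
    ∃ M, ∀ n, |B.par h (i, n)| ≤ M := by
  set x : X := ⟨B.x i, B.x_mem i⟩
  obtain ⟨K, U, hU, hK⟩ := hh.1 x
  obtain ⟨L, V, hV, hL⟩ := hh.2 ((h : X ≃ₜ X) x)
  have hW : U ∩ (h : X ≃ₜ X) ⁻¹' V ∈ 𝓝 x :=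
    Filter.inter_mem hU ((h : X ≃ₜ X).continuous.continuousAt.preimage_mem_nhds hV)
  obtain ⟨r, hr, hball⟩ := Metric.mem_nhds_iff.1 hW
  obtain ⟨n₀, hn₀⟩ := Filter.eventually_atTop.1 ((B.tendsto_scale i).eventually (gt_mem_nhds hr))
  have hbd : ∀ n ≥ n₀, |B.par h (i, n)| ≤ ((K : ℝ) + L + 1) ^ 2 := by
    intro n hn
    have hmem : ∀ s, B.pt (i, n) s ∈ U ∩ (h : X ≃ₜ X) ⁻¹' V := fun s =>
      hball ((B.dist_pt_x_lt (i, n) s).trans (hn₀ n hn))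
    refine B.abs_par_le (by positivity) (fun s s' => ?_) fun s s' => ?_
    · refine (hK.dist_le_mul _ (hmem s).1 _ (hmem s').1).trans ?_
      gcongr
      linarith [L.coe_nonneg]
    · have := hL.dist_le_mul _ (hmem s).2 _ (hmem s').2
      simp only [Homeomorph.symm_apply_apply] at this
      refine this.trans ?_
      unfold arc
      gcongr
      linarith [K.coe_nonneg]
  refine ⟨((K : ℝ) + L + 1) ^ 2 + ∑ n ∈ Finset.range n₀, |B.par h (i, n)|, fun n => ?_⟩
  have hs : 0 ≤ ∑ n ∈ Finset.range n₀, |B.par h (i, n)| :=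
    Finset.sum_nonneg fun _ _ => abs_nonneg _
  rcases le_or_gt n₀ n with hn | hn
  · linarith [hbd n hn]
  · have := Finset.single_le_sum (f := fun n => |B.par h (i, n)|) (fun _ _ => abs_nonneg _)
      (Finset.mem_range.2 hn)
    have h3 : (0 : ℝ) ≤ ((K : ℝ) + L + 1) ^ 2 := by positivity
    linarith

theorem finite_rows_of_mem_homeoCompactSupport {h : homeoRel X A}
    (hh : h ∈ homeoCompactSupport X A) : {i | ∃ n, B.par h (i, n) ≠ 0}.Finite := by
  have hc : IsCompact (Subtype.val '' closure {x : X | (h : X ≃ₜ X) x ≠ x}) :=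
    IsCompact.image hh continuous_subtype_val
  refine (B.locallyFinite_closedBall.finite_nonempty_inter_compact hc).subset ?_
  rintro i ⟨n, hn⟩
  by_contra hi
  refine hn (B.par_eq_zero_of_fixed fun s => ?_)
  by_contra hs
  exact hi ⟨B.pt (i, n) s, ((B.dist_pt_x_lt (i, n) s).le.trans (B.scale_le _)).trans (B.ε_le i),
    B.pt (i, n) s, subset_closure hs, rfl⟩

/-- Some cell of linearity contains an initial piece of the ray from the flat point. All axes far
enough along the row lie in that piece, where h is affine and scales distances uniformly, so their
balance points are the midpoints. -/
theorem finite_row_of_mem_homeoPL {h : homeoRel X A} (hh : h ∈ homeoPL X A) (i : ι) :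
    {n | B.par h (i, n) ≠ 0}.Finite := by
  obtain ⟨-, 𝒞, hcell, hlf, hcov, haff⟩ := hh.1
  let y : ℝ → EuclideanSpace ℝ (Fin N) := fun a => B.x i + a • B.e i
  have hy : Continuous y := by fun_prop
  have hy0 : y 0 = B.x i := by simp [y]
  have hyt : Filter.Tendsto y (𝓝[>] 0) (𝓝 (B.x i)) := by
    rw [← hy0]
    exact hy.continuousAt.tendsto.mono_left nhdsWithin_le_nhds
  -- An affine function on the ray does not alternate sign near the origin, so each convex cell
  -- either contains a whole initial piece of the ray or misses one.
  have hg : ∀ g : EuclideanSpace ℝ (Fin N) →ᵃ[ℝ] ℝ,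
      (∀ᶠ a in 𝓝[>] (0 : ℝ), 0 ≤ g (y a)) ∨ ∀ᶠ a in 𝓝[>] (0 : ℝ), g (y a) < 0 := by
    intro g
    have hgy : ∀ a, g (y a) = g (B.x i) + a * g.linear (B.e i) := by
      intro a
      have := g.map_vadd (B.x i) (a • B.e i)
      rw [vadd_eq_add, vadd_eq_add, map_smul, smul_eq_mul] at this
      rw [add_comm, ← this, add_comm]
    have hgc : Continuous fun a => g (y a) := g.continuous_of_finiteDimensional.comp hy
    rcases lt_trichotomy (g (B.x i)) 0 with h | h | h
    · right
      exact nhdsWithin_le_nhds (hgc.continuousAt.eventually_lt_const (by simpa only [hy0] using h))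
    · rcases le_or_gt 0 (g.linear (B.e i)) with h' | h'
      · left
        filter_upwards [self_mem_nhdsWithin] with a ha
        rw [hgy, h, zero_add]
        exact mul_nonneg (le_of_lt ha) h'
      · right
        filter_upwards [self_mem_nhdsWithin] with a ha
        rw [hgy, h, zero_add]
        exact mul_neg_of_pos_of_neg ha h'
    · left
      have hev : ∀ᶠ a in 𝓝[>] (0 : ℝ), 0 < g (y a) := nhdsWithin_le_nhds
        (hgc.continuousAt.eventually_const_lt (by simpa only [hy0] using h))
      exact hev.mono fun _ h => le_of_lt h
  have hC : ∀ C ∈ 𝒞, (∀ᶠ a in 𝓝[>] (0 : ℝ), y a ∈ C) ∨ ∀ᶠ a in 𝓝[>] (0 : ℝ), y a ∉ C := by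
    intro C hC
    obtain ⟨-, G, hG, rfl⟩ := hcell C hC
    by_cases hall : ∀ g ∈ G, ∀ᶠ a in 𝓝[>] (0 : ℝ), 0 ≤ g (y a)
    · left
      exact (Filter.eventually_all_finite hG).2 hall
    · right
      simp only [not_forall] at hall
      obtain ⟨g, hgG, hgn⟩ := hall
      filter_upwards [(hg g).resolve_left hgn] with a ha hmem
      exact ha.not_ge (hmem g hgG)
  -- Otherwise the finitely many cells near the flat point would all miss some initial piece, which
  -- nevertheless lies in X.
  obtain ⟨C, hCmem, hCev⟩ : ∃ C ∈ 𝒞, ∀ᶠ a in 𝓝[>] (0 : ℝ), y a ∈ C := by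
    by_contra hno
    simp only [not_exists, not_and] at hno
    obtain ⟨U, hU, hfin⟩ := hlf (B.x i)
    have h1 : ∀ᶠ a in 𝓝[>] (0 : ℝ), ∀ C ∈ {C : 𝒞 | ((C : Set (EuclideanSpace ℝ (Fin N))) ∩
        U).Nonempty}, y a ∉ C.1 :=
      (Filter.eventually_all_finite hfin).2 fun C _ => (hC C C.2).resolve_left (hno C C.2)
    have h2 : ∀ᶠ a in 𝓝[>] (0 : ℝ), y a ∈ X := by
      filter_upwards [hyt.eventually (Metric.ball_mem_nhds (B.x i) (B.ε_pos i))] with a ha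
      exact B.flat i _ (B.x_mem i) (by simpa using B.ε_pos i) a ha
    obtain ⟨a, ha1, ha2, ha3⟩ := (h1.and (h2.and (hyt.eventually hU))).exists
    rw [← hcov] at ha2
    obtain ⟨C, hC', hCa⟩ := ha2
    exact ha1 ⟨C, hC'⟩ ⟨_, hCa, ha3⟩ hCa
  obtain ⟨a, ha⟩ := haff C hCmem
  obtain ⟨η, hη, hηC⟩ := (mem_nhdsGT_iff_exists_Ioo_subset).1 hCev
  obtain ⟨n₀, hn₀⟩ := Filter.eventually_atTop.1 ((B.tendsto_scale i).eventually (gt_mem_nhds hη))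
  refine (Set.finite_lt_nat n₀).subset fun n hn => ?_
  by_contra hlt
  have hsc := hn₀ n (not_lt.1 hlt)
  have hpos := B.scale_pos (i, n)
  refine hn (B.par_eq_zero (C := ‖(B.rad (i, n)) • a.linear (B.e i)‖) fun s hs s' hs' => ?_)
  have key : ∀ s ∈ Icc (-1 : ℝ) 1, (B.arc h (i, n) s : EuclideanSpace ℝ (Fin N)) =
      a (B.ctr (i, n)) + (B.rad (i, n) * s) • a.linear (B.e i) := by
    intro s hs
    unfold arc
    rw [ha, B.coe_pt _ hs]
    · have := a.map_vadd (B.ctr (i, n)) ((B.rad (i, n) * s) • B.e i)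
      rw [vadd_eq_add, vadd_eq_add, map_smul] at this
      rw [add_comm, ← this, add_comm]
      rfl
    · rw [B.coe_pt _ hs, axis_eq]
      exact hηC ⟨by nlinarith [hs.1], by nlinarith [hs.2]⟩
  rw [Subtype.dist_eq, key s hs, key s' hs', dist_add_left, dist_eq_norm, ← sub_smul, ← mul_sub,
    mul_comm, mul_smul, norm_smul, Real.norm_eq_abs, mul_comm]

end FlatFamily

/-! ### Stability from a slice -/

section Stability

variable {N : ℕ} {X A : Set (EuclideanSpace ℝ (Fin N))}
  {E : Type*} [TopologicalSpace E] [AddCommGroup E] [Module ℝ E]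

/-- A stability homeomorphism which fixes the base points and has star-shaped model spaces
preserves the identity components. -/
theorem preservesIdentityComponents_of_map_base [ContinuousAdd E] [ContinuousSMul ℝ E] {n : ℕ}
    {Y : Type*} [TopologicalSpace Y] [One Y] {Yt : Fin n → Set Y} {Et : Fin n → Set E}
    {Φ : Y × E ≃ₜ Y} (hΦ : IsStabilityHomeo Yt Et Φ) (hbase : Φ (1, 0) = 1)
    (hone : ∀ i, 1 ∈ Yt i) (hzero : ∀ i, 0 ∈ Et i) (hE : ∀ i, StarConvex ℝ 0 (Et i)) :
    PreservesIdentityComponents Yt Et Φ := by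
  intro i
  have hmaps : MapsTo Φ (Yt i ×ˢ Et i) (Yt i) := by
    rw [mapsTo_iff_image_subset]
    exact (hΦ i).subset
  apply Subset.antisymm
  · refine IsPreconnected.subset_connectedComponentIn ?_ ?_ ?_
    · exact (isPreconnected_connectedComponentIn.prod
        ((hE i).isPathConnected (hzero i)).isConnected.isPreconnected).image _
        Φ.continuous.continuousOn
    · exact ⟨(1, 0), ⟨mem_connectedComponentIn (hone i), hzero i⟩, hbase⟩
    · rw [image_subset_iff]
      exact fun p hp => hmaps ⟨connectedComponentIn_subset _ _ hp.1, hp.2⟩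
  · intro y hy
    have hsymm : ∀ z ∈ Yt i, Φ.symm z ∈ Yt i ×ˢ Et i := by
      intro z hz
      rw [← hΦ i] at hz
      obtain ⟨p, hp, rfl⟩ := hz
      rwa [Φ.symm_apply_apply]
    -- The image of the component under the first coordinate of Φ⁻¹ is connected and contains 1, as
    -- Φ⁻¹ fixes the base point.
    have hsub : (fun z => (Φ.symm z).1) '' connectedComponentIn (Yt i) 1 ⊆
        connectedComponentIn (Yt i) 1 := by
      refine IsPreconnected.subset_connectedComponentIn ?_ ?_ ?_
      · exact isPreconnected_connectedComponentIn.image _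
          (continuous_fst.comp Φ.symm.continuous).continuousOn
      · refine ⟨1, mem_connectedComponentIn (hone i), ?_⟩
        change (Φ.symm 1).1 = 1
        rw [Φ.symm_apply_eq.2 hbase.symm]
      · rintro _ ⟨z, hz, rfl⟩
        exact (hsymm z (connectedComponentIn_subset _ _ hz)).1
    exact ⟨Φ.symm y, ⟨hsub ⟨y, hy, rfl⟩, (hsymm y (connectedComponentIn_subset _ _ hy)).2⟩,
      Φ.apply_symm_apply y⟩

/-- If `𝓗_A(X)` is the product of a slice `{par = 0}` and a model space, compatibly with the
subgroups, and the model space is homeomorphic to its square, then the tuple is stable. -/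
theorem exists_stabilityHomeo_of_slice [ContinuousAdd E] [ContinuousSMul ℝ E]
    {par : homeoRel X A → E} {F : E → homeoRel X A} (hpar : Continuous par)
    (hF : Continuous fun p : homeoRel X A × E => p.1 * F p.2)
    (hF' : Continuous fun p : homeoRel X A × E => p.1 * (F p.2)⁻¹)
    (hslice : ∀ h τ, par (h * F τ) = 0 ↔ par h = τ) (hF0 : F 0 = 1) (hpar1 : par 1 = 0)
    {Et : Fin 6 → Set E} (hE : ∀ i, StarConvex ℝ 0 (Et i)) (hE0 : ∀ i, 0 ∈ Et i)
    (hparE : ∀ i, ∀ h ∈ homeoTuple X A i, par h ∈ Et i)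
    (hFE : ∀ i, ∀ τ ∈ Et i, F τ ∈ homeoTuple X A i)
    (θ : E × E ≃ₜ E) (hθ0 : θ (0, 0) = 0) (hθ : ∀ i p, θ p ∈ Et i ↔ p.1 ∈ Et i ∧ p.2 ∈ Et i) :
    ∃ Φ : homeoRel X A × E ≃ₜ homeoRel X A,
      IsStabilityHomeo (homeoTuple X A) Et Φ ∧
      PreservesIdentityComponents (homeoTuple X A) Et Φ := by
  have hs : ∀ h, par (h * F (par h)) = 0 := fun h => (hslice _ _).2 rfl
  have hp : ∀ s τ, par s = 0 → par (s * (F τ)⁻¹) = τ := fun s τ h =>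
    (hslice _ _).1 (by rwa [inv_mul_cancel_right])
  -- Write h = s · (F (par h))⁻¹ with s in the slice; Φ keeps s and replaces the parameter `par h`
  -- by θ (par h, τ), and its inverse splits the parameter by θ⁻¹.
  let Φ : homeoRel X A × E ≃ₜ homeoRel X A :=
    { toFun := fun p => p.1 * F (par p.1) * (F (θ (par p.1, p.2)))⁻¹
      invFun := fun g => (g * F (par g) * (F (θ.symm (par g)).1)⁻¹, (θ.symm (par g)).2)
      left_inv := by
        rintro ⟨h, τ⟩
        have h1 := hp _ (θ (par h, τ)) (hs h)
        simp only [h1, inv_mul_cancel_right, θ.symm_apply_apply, mul_inv_cancel_right]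
      right_inv := by
        intro g
        have h1 := hp _ (θ.symm (par g)).1 (hs g)
        simp only [h1, inv_mul_cancel_right, Prod.mk.eta, θ.apply_symm_apply,
          mul_inv_cancel_right]
      continuous_toFun := by
        have h1 : Continuous fun p : homeoRel X A × E => p.1 * F (par p.1) :=
          hF.comp (continuous_fst.prodMk (hpar.comp continuous_fst))
        exact hF'.comp (h1.prodMk (θ.continuous.comp
          ((hpar.comp continuous_fst).prodMk continuous_snd)))
      continuous_invFun := by
        have h1 : Continuous fun g : homeoRel X A => g * F (par g) :=
          hF.comp (continuous_id.prodMk hpar)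
        have h2 : Continuous fun g : homeoRel X A => θ.symm (par g) :=
          θ.symm.continuous.comp hpar
        exact (hF'.comp (h1.prodMk (continuous_fst.comp h2))).prodMk (continuous_snd.comp h2) }
  have hΦ : ∀ p, Φ p = p.1 * F (par p.1) * (F (θ (par p.1, p.2)))⁻¹ := fun _ => rfl
  have hΦ' : ∀ g, Φ.symm g = (g * F (par g) * (F (θ.symm (par g)).1)⁻¹, (θ.symm (par g)).2) :=
    fun _ => rfl
  have hstab : IsStabilityHomeo (homeoTuple X A) Et Φ := by
    intro i
    apply Subset.antisymm
    · rintro _ ⟨⟨h, τ⟩, ⟨hh, hτ⟩, rfl⟩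
      rw [hΦ]
      have h1 := hparE i h hh
      exact mul_mem_homeoTuple i (mul_mem_homeoTuple i hh (hFE i _ h1))
        (inv_mem_homeoTuple i (hFE i _ ((hθ i _).2 ⟨h1, hτ⟩)))
    · intro g hg
      have h1 := hparE i g hg
      have h2 := (hθ i (θ.symm (par g))).1 (by rwa [θ.apply_symm_apply])
      refine ⟨Φ.symm g, ?_, Φ.apply_symm_apply g⟩
      rw [hΦ']
      exact ⟨mul_mem_homeoTuple i (mul_mem_homeoTuple i hg (hFE i _ h1))
        (inv_mem_homeoTuple i (hFE i _ h2.1)), h2.2⟩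
  refine ⟨Φ, hstab, preservesIdentityComponents_of_map_base hstab ?_ (fun i => ?_) hE0 hE⟩
  · rw [hΦ]
    simp only [hpar1, hθ0, hF0, mul_one, inv_one]
  · rw [← hF0]
    exact hFE i 0 (hE0 i)

end Stability

/-! ### The model spaces -/

section Models

/-- Interleaving two sequences. -/
def interleave : (ℕ → ℝ) × (ℕ → ℝ) ≃ₜ (ℕ → ℝ) where
  toFun p n := Sum.elim p.1 p.2 (Equiv.natSumNatEquivNat.symm n)
  invFun x := (fun n => x (Equiv.natSumNatEquivNat (Sum.inl n)),
    fun n => x (Equiv.natSumNatEquivNat (Sum.inr n)))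
  left_inv p := by simp
  right_inv x := by
    funext n
    obtain ⟨m, rfl⟩ := Equiv.natSumNatEquivNat.surjective n
    beta_reduce
    rw [Equiv.symm_apply_apply]
    cases m <;> rfl
  continuous_toFun := by
    refine continuous_pi fun n => ?_
    rcases Equiv.natSumNatEquivNat.symm n with m | m
    · exact (continuous_apply m).comp continuous_fst
    · exact (continuous_apply m).comp continuous_snd
  continuous_invFun := by fun_prop

theorem interleave_inl (p : (ℕ → ℝ) × (ℕ → ℝ)) (n : ℕ) :
    interleave p (Equiv.natSumNatEquivNat (Sum.inl n)) = p.1 n := by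
  change Sum.elim p.1 p.2 (Equiv.natSumNatEquivNat.symm _) = _
  rw [Equiv.symm_apply_apply, Sum.elim_inl]

theorem interleave_inr (p : (ℕ → ℝ) × (ℕ → ℝ)) (n : ℕ) :
    interleave p (Equiv.natSumNatEquivNat (Sum.inr n)) = p.2 n := by
  change Sum.elim p.1 p.2 (Equiv.natSumNatEquivNat.symm _) = _
  rw [Equiv.symm_apply_apply, Sum.elim_inr]

theorem forall_interleave_iff {P : ℝ → Prop} (p : (ℕ → ℝ) × (ℕ → ℝ)) :
    (∀ n, P (interleave p n)) ↔ (∀ n, P (p.1 n)) ∧ ∀ n, P (p.2 n) := by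
  rw [← Equiv.natSumNatEquivNat.forall_congr_right, Sum.forall]
  simp only [interleave_inl, interleave_inr]

theorem interleave_eq_zero_iff (p : (ℕ → ℝ) × (ℕ → ℝ)) :
    interleave p = 0 ↔ p.1 = 0 ∧ p.2 = 0 := by
  simp only [funext_iff, Pi.zero_apply]
  exact forall_interleave_iff (P := fun x => x = 0) p

theorem interleave_zero : interleave (0, 0) = 0 :=
  (interleave_eq_zero_iff (0, 0)).2 ⟨rfl, rfl⟩

theorem interleave_mem_modelSigma_iff (p : (ℕ → ℝ) × (ℕ → ℝ)) :
    interleave p ∈ modelSigma ↔ p.1 ∈ modelSigma ∧ p.2 ∈ modelSigma := by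
  constructor
  · rintro ⟨M, hM⟩
    have := (forall_interleave_iff (P := fun x => |x| ≤ M) p).1 hM
    exact ⟨⟨M, this.1⟩, ⟨M, this.2⟩⟩
  · rintro ⟨⟨M, hM⟩, ⟨M', hM'⟩⟩
    exact ⟨max M M', (forall_interleave_iff (P := fun x => |x| ≤ max M M') p).2
      ⟨fun n => (hM n).trans (le_max_left _ _), fun n => (hM' n).trans (le_max_right _ _)⟩⟩

theorem interleave_mem_modelFin_iff (p : (ℕ → ℝ) × (ℕ → ℝ)) :
    interleave p ∈ modelFin ↔ p.1 ∈ modelFin ∧ p.2 ∈ modelFin := by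
  have h : {n | interleave p n ≠ 0} = Equiv.natSumNatEquivNat ''
      (Sum.inl '' {n | p.1 n ≠ 0} ∪ Sum.inr '' {n | p.2 n ≠ 0}) := by
    ext n
    obtain ⟨m, rfl⟩ := Equiv.natSumNatEquivNat.surjective n
    rw [Equiv.injective _ |>.mem_set_image]
    cases m <;> simp only [mem_ofPred_eq, interleave_inl, interleave_inr] <;> simp
  unfold modelFin
  rw [mem_ofPred_eq, h, finite_image_iff (Equiv.injective _).injOn, finite_union,
    finite_image_iff Sum.inl_injective.injOn, finite_image_iff Sum.inr_injective.injOn]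
  rfl

/-- Interleaving two sequences of sequences termwise. -/
def interleaveSeq : (ℕ → ℕ → ℝ) × (ℕ → ℕ → ℝ) ≃ₜ (ℕ → ℕ → ℝ) where
  toFun p m := interleave (p.1 m, p.2 m)
  invFun x := (fun m => (interleave.symm (x m)).1, fun m => (interleave.symm (x m)).2)
  left_inv p := by simp
  right_inv x := by simp
  continuous_toFun := continuous_pi fun m => interleave.continuous.comp
    (((continuous_apply m).comp continuous_fst).prodMk ((continuous_apply m).comp continuous_snd))
  continuous_invFun := by
    have h : ∀ m, Continuous fun x : ℕ → ℕ → ℝ => interleave.symm (x m) := fun m =>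
      interleave.symm.continuous.comp (continuous_apply m)
    exact (continuous_pi fun m => continuous_fst.comp (h m)).prodMk
      (continuous_pi fun m => continuous_snd.comp (h m))

theorem interleaveSeq_apply (p : (ℕ → ℕ → ℝ) × (ℕ → ℕ → ℝ)) (m : ℕ) :
    interleaveSeq p m = interleave (p.1 m, p.2 m) := rfl

theorem interleaveSeq_zero : interleaveSeq (0, 0) = 0 := by
  funext m
  rw [interleaveSeq_apply]
  exact interleave_zero

theorem interleaveSeq_mem_seqIn_iff {S : Set (ℕ → ℝ)}
    (hS : ∀ p, interleave p ∈ S ↔ p.1 ∈ S ∧ p.2 ∈ S) (p : (ℕ → ℕ → ℝ) × (ℕ → ℕ → ℝ)) :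
    interleaveSeq p ∈ seqIn S ↔ p.1 ∈ seqIn S ∧ p.2 ∈ seqIn S := by
  simp only [seqIn, mem_ofPred_eq, interleaveSeq_apply, hS]
  exact forall_and

theorem interleaveSeq_mem_seqInFin_iff {S : Set (ℕ → ℝ)}
    (hS : ∀ p, interleave p ∈ S ↔ p.1 ∈ S ∧ p.2 ∈ S) (p : (ℕ → ℕ → ℝ) × (ℕ → ℕ → ℝ)) :
    interleaveSeq p ∈ seqInFin S ↔ p.1 ∈ seqInFin S ∧ p.2 ∈ seqInFin S := by
  have h : {m | interleaveSeq p m ≠ 0} = {m | p.1 m ≠ 0} ∪ {m | p.2 m ≠ 0} := by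
    ext m
    simp only [mem_ofPred_eq, mem_union, interleaveSeq_apply, ne_eq, interleave_eq_zero_iff]
    tauto
  simp only [seqInFin, mem_ofPred_eq, interleaveSeq_mem_seqIn_iff hS, h, finite_union]
  tauto

theorem interleaveSeq_mem_seqBounded_iff (p : (ℕ → ℕ → ℝ) × (ℕ → ℕ → ℝ)) :
    interleaveSeq p ∈ seqBounded ↔ p.1 ∈ seqBounded ∧ p.2 ∈ seqBounded := by
  constructor
  · rintro ⟨M, hM⟩
    have := fun m => (forall_interleave_iff (P := fun x => |x| ≤ M) (p.1 m, p.2 m)).1 (hM m)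
    exact ⟨⟨M, fun m => (this m).1⟩, ⟨M, fun m => (this m).2⟩⟩
  · rintro ⟨⟨M, hM⟩, ⟨M', hM'⟩⟩
    exact ⟨max M M', fun m => (forall_interleave_iff (P := fun x => |x| ≤ max M M') _).2
      ⟨fun n => (hM m n).trans (le_max_left _ _), fun n => (hM' m n).trans (le_max_right _ _)⟩⟩

theorem interleave_mem_modelTuple_iff (i : Fin 6) (p : (ℕ → ℝ) × (ℕ → ℝ)) :
    interleave p ∈ modelTuple i ↔ p.1 ∈ modelTuple i ∧ p.2 ∈ modelTuple i := by
  fin_cases i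
  · exact ⟨fun _ => ⟨trivial, trivial⟩, fun _ => trivial⟩
  · exact interleave_mem_modelSigma_iff p
  · exact interleave_mem_modelSigma_iff p
  · exact interleave_mem_modelSigma_iff p
  · exact interleave_mem_modelFin_iff p
  · exact interleave_mem_modelFin_iff p

theorem interleaveSeq_mem_modelTupleInfty_iff (i : Fin 6) (p : (ℕ → ℕ → ℝ) × (ℕ → ℕ → ℝ)) :
    interleaveSeq p ∈ modelTupleInfty i ↔ p.1 ∈ modelTupleInfty i ∧ p.2 ∈ modelTupleInfty i := by
  fin_cases i
  · exact ⟨fun _ => ⟨trivial, trivial⟩, fun _ => trivial⟩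
  · exact interleaveSeq_mem_seqIn_iff interleave_mem_modelSigma_iff p
  · exact interleaveSeq_mem_seqBounded_iff p
  · exact interleaveSeq_mem_seqInFin_iff interleave_mem_modelSigma_iff p
  · exact interleaveSeq_mem_seqIn_iff interleave_mem_modelFin_iff p
  · exact interleaveSeq_mem_seqInFin_iff interleave_mem_modelFin_iff p

theorem smul_mem_modelSigma {x : ℕ → ℝ} (hx : x ∈ modelSigma) (r : ℝ) : r • x ∈ modelSigma := by
  obtain ⟨M, hM⟩ := hx
  refine ⟨|r| * M, fun n => ?_⟩
  rw [Pi.smul_apply, smul_eq_mul, abs_mul]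
  exact mul_le_mul_of_nonneg_left (hM n) (abs_nonneg r)

theorem smul_mem_modelFin {x : ℕ → ℝ} (hx : x ∈ modelFin) (r : ℝ) : r • x ∈ modelFin :=
  Finite.subset hx fun n hn h => hn (by rw [Pi.smul_apply, h, smul_zero])

theorem smul_mem_modelTuple (i : Fin 6) {x : ℕ → ℝ} (hx : x ∈ modelTuple i) (r : ℝ) :
    r • x ∈ modelTuple i := by
  fin_cases i
  · trivial
  · exact smul_mem_modelSigma hx r
  · exact smul_mem_modelSigma hx r
  · exact smul_mem_modelSigma hx r
  · exact smul_mem_modelFin hx r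
  · exact smul_mem_modelFin hx r

theorem smul_mem_modelTupleInfty (i : Fin 6) {x : ℕ → ℕ → ℝ} (hx : x ∈ modelTupleInfty i) (r : ℝ) :
    r • x ∈ modelTupleInfty i := by
  have hfin : ∀ {x : ℕ → ℕ → ℝ}, {n | x n ≠ 0}.Finite → {n | (r • x) n ≠ 0}.Finite := fun hx =>
    Finite.subset hx fun n hn h => hn (by rw [Pi.smul_apply, h, smul_zero])
  fin_cases i
  · trivial
  · exact fun n => smul_mem_modelSigma (hx n) r
  · obtain ⟨M, hM⟩ := hx
    refine ⟨|r| * M, fun m n => ?_⟩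
    rw [Pi.smul_apply, Pi.smul_apply, smul_eq_mul, abs_mul]
    exact mul_le_mul_of_nonneg_left (hM m n) (abs_nonneg r)
  · exact ⟨fun n => smul_mem_modelSigma (hx.1 n) r, hfin hx.2⟩
  · exact fun n => smul_mem_modelFin (hx n) r
  · exact ⟨fun n => smul_mem_modelFin (hx.1 n) r, hfin hx.2⟩

theorem zero_mem_modelSigma : (0 : ℕ → ℝ) ∈ modelSigma := ⟨0, by simp⟩

theorem zero_mem_modelFin : (0 : ℕ → ℝ) ∈ modelFin := by simp [modelFin]

theorem zero_mem_modelTuple (i : Fin 6) : 0 ∈ modelTuple i := by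
  fin_cases i
  · trivial
  · exact zero_mem_modelSigma
  · exact zero_mem_modelSigma
  · exact zero_mem_modelSigma
  · exact zero_mem_modelFin
  · exact zero_mem_modelFin

theorem zero_mem_modelTupleInfty (i : Fin 6) : 0 ∈ modelTupleInfty i := by
  have h : {n | (0 : ℕ → ℕ → ℝ) n ≠ 0}.Finite := by simp
  fin_cases i
  · trivial
  · exact fun _ => zero_mem_modelSigma
  · exact ⟨0, by simp⟩
  · exact ⟨fun _ => zero_mem_modelSigma, h⟩
  · exact fun _ => zero_mem_modelFin
  · exact ⟨fun _ => zero_mem_modelFin, h⟩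

theorem starConvex_zero_of_smul_mem {E : Type*} [AddCommGroup E] [Module ℝ E] {S : Set E}
    (h : ∀ x ∈ S, ∀ r : ℝ, r • x ∈ S) : StarConvex ℝ 0 S := by
  intro y hy a b _ _ _
  rw [smul_zero, zero_add]
  exact h y hy b

end Models

/-! ### Stability from a flat family -/

namespace FlatFamily

variable {N : ℕ} {X A : Set (EuclideanSpace ℝ (Fin N))}

theorem exists_stabilityHomeo {T : Geometry.SimplicialComplex ℝ (EuclideanSpace ℝ (Fin N))}
    (hT : IsTriangulation T X) (B : FlatFamily X A Unit) :
    ∃ Φ : homeoRel X A × (ℕ → ℝ) ≃ₜ homeoRel X A,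
      IsStabilityHomeo (homeoTuple X A) modelTuple Φ ∧
      PreservesIdentityComponents (homeoTuple X A) modelTuple Φ := by
  have : LocallyCompactSpace X := hT.isClosed.isClosedEmbedding_subtypeVal.locallyCompactSpace
  let R : (ℕ → ℝ) → Unit × ℕ → ℝ := fun τ k => τ k.2
  have hR : Continuous R := continuous_pi fun k => continuous_apply k.2
  have hsig : ∀ h ∈ homeoLocLip X A, (fun n => B.par h ((), n)) ∈ modelSigma := fun h hh =>
    B.bounded_par_of_mem_homeoLocLip hh ()
  have hlip : homeoLip X A ⊆ homeoLocLip X A := fun h hh =>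
    ⟨hh.1.elim fun _ hK => hK.locallyLipschitz, hh.2.elim fun _ hK => hK.locallyLipschitz⟩
  have hFsig : ∀ τ ∈ modelSigma, B.homeo (R τ) ∈ homeoLip X A := fun τ hτ =>
    B.homeo_mem_homeoLip (hτ.imp fun M hM k => hM k.2)
  have hFfin : ∀ τ ∈ modelFin, B.homeo (R τ) ∈ homeoPL X A := fun τ hτ =>
    B.homeo_mem_homeoPL hT fun _ => hτ
  -- All cells lie in one ball, so compact support imposes no condition on the parameters.
  have hcs : ∀ τ, B.homeo (R τ) ∈ homeoCompactSupport X A := fun τ =>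
    B.homeo_mem_homeoCompactSupport hT.isClosed (toFinite _)
  refine exists_stabilityHomeo_of_slice (par := fun h n => B.par h ((), n))
    (F := fun τ => B.homeo (R τ)) ?_ ?_ ?_ ?_ ?_ ?_ (fun i => starConvex_zero_of_smul_mem
      fun x hx r => smul_mem_modelTuple i hx r) zero_mem_modelTuple ?_ ?_ interleave
    interleave_zero interleave_mem_modelTuple_iff
  · exact continuous_pi fun n => (continuous_apply ((), n)).comp B.continuous_par
  · exact B.continuous_mul_homeo continuous_fst (hR.comp continuous_snd)
  · exact B.continuous_mul_homeo_inv continuous_fst (hR.comp continuous_snd)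
  · intro h τ
    have := B.par_mul_homeo_eq_zero_iff h (R τ)
    simp only [funext_iff, Prod.forall, Pi.zero_apply] at this ⊢
    exact ⟨fun h0 => this.1 (fun _ => h0) (), fun h0 => this.2 (fun _ => h0) ()⟩
  · exact B.homeo_zero
  · rw [B.par_one]
    rfl
  · intro i h hh
    fin_cases i
    · trivial
    · exact hsig h hh
    · exact hsig h (hlip hh)
    · exact hsig h (hlip hh.1)
    · exact B.finite_row_of_mem_homeoPL hh ()
    · exact B.finite_row_of_mem_homeoPL hh.1 ()
  · intro i τ hτ
    fin_cases i
    · trivial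
    · exact hlip (hFsig τ hτ)
    · exact hFsig τ hτ
    · exact ⟨hFsig τ hτ, hcs τ⟩
    · exact hFfin τ hτ
    · exact ⟨hFfin τ hτ, hcs τ⟩

theorem exists_stabilityHomeo_infty
    {T : Geometry.SimplicialComplex ℝ (EuclideanSpace ℝ (Fin N))}
    (hT : IsTriangulation T X) (B : FlatFamily X A ℕ) :
    ∃ Φ : homeoRel X A × (ℕ → ℕ → ℝ) ≃ₜ homeoRel X A,
      IsStabilityHomeo (homeoTuple X A) modelTupleInfty Φ ∧
      PreservesIdentityComponents (homeoTuple X A) modelTupleInfty Φ := by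
  have : LocallyCompactSpace X := hT.isClosed.isClosedEmbedding_subtypeVal.locallyCompactSpace
  let R : (ℕ → ℕ → ℝ) → ℕ × ℕ → ℝ := fun τ k => τ k.1 k.2
  have hR : Continuous R := continuous_pi fun k =>
    (continuous_apply k.2).comp (continuous_apply k.1)
  have hrow : ∀ τ : ℕ → ℕ → ℝ, {m | τ m ≠ 0} = {m | ∃ n, τ m n ≠ 0} := fun τ => by
    ext m
    simp [funext_iff]
  have hlip : homeoLip X A ⊆ homeoLocLip X A := fun h hh =>
    ⟨hh.1.elim fun _ hK => hK.locallyLipschitz, hh.2.elim fun _ hK => hK.locallyLipschitz⟩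
  have hparc : ∀ h ∈ homeoCompactSupport X A, {m | (fun n => B.par h (m, n)) ≠ 0}.Finite := by
    intro h hh
    rw [hrow fun m n => B.par h (m, n)]
    exact B.finite_rows_of_mem_homeoCompactSupport hh
  have hFc : ∀ τ : ℕ → ℕ → ℝ, {m | τ m ≠ 0}.Finite → B.homeo (R τ) ∈ homeoCompactSupport X A := by
    intro τ hτ
    rw [hrow] at hτ
    exact B.homeo_mem_homeoCompactSupport hT.isClosed hτ
  have hFlip : ∀ τ ∈ seqBounded, B.homeo (R τ) ∈ homeoLip X A := fun τ hτ =>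
    B.homeo_mem_homeoLip (hτ.imp fun M hM k => hM k.1 k.2)
  have hFpl : ∀ τ ∈ seqIn modelFin, B.homeo (R τ) ∈ homeoPL X A := fun τ hτ =>
    B.homeo_mem_homeoPL hT hτ
  -- Finitely many nonzero rows, each bounded, are uniformly bounded; the corresponding
  -- homeomorphisms are then globally Lipschitz.
  have hbdd : ∀ τ ∈ seqInFin modelSigma, τ ∈ seqBounded := by
    rintro τ ⟨h1, h2⟩
    choose M hM using h1
    refine ⟨∑ m ∈ h2.toFinset, |M m|, fun m n => ?_⟩
    by_cases hm : τ m = 0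
    · rw [hm, Pi.zero_apply, abs_zero]
      exact Finset.sum_nonneg fun _ _ => abs_nonneg _
    · exact ((hM m n).trans (le_abs_self _)).trans (Finset.single_le_sum (f := fun m => |M m|)
        (fun _ _ => abs_nonneg _) (h2.mem_toFinset.2 hm))
  refine exists_stabilityHomeo_of_slice (par := fun h m n => B.par h (m, n))
    (F := fun τ => B.homeo (R τ)) ?_ ?_ ?_ ?_ ?_ ?_ (fun i => starConvex_zero_of_smul_mem
      fun x hx r => smul_mem_modelTupleInfty i hx r) zero_mem_modelTupleInfty ?_ ?_ interleaveSeq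
    interleaveSeq_zero interleaveSeq_mem_modelTupleInfty_iff
  · exact continuous_pi fun m => continuous_pi fun n =>
      (continuous_apply (m, n)).comp B.continuous_par
  · exact B.continuous_mul_homeo continuous_fst (hR.comp continuous_snd)
  · exact B.continuous_mul_homeo_inv continuous_fst (hR.comp continuous_snd)
  · intro h τ
    have := B.par_mul_homeo_eq_zero_iff h (R τ)
    simp only [funext_iff, Prod.forall, Pi.zero_apply] at this ⊢
    exact this
  · exact B.homeo_zero
  · rw [B.par_one]
    rfl
  · intro i h hh
    fin_cases i
    · trivial
    · exact fun m => B.bounded_par_of_mem_homeoLocLip hh m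
    · exact (B.bounded_par_of_mem_homeoLip hh).imp fun M hM m n => hM (m, n)
    · exact ⟨fun m => B.bounded_par_of_mem_homeoLocLip (hlip hh.1) m, hparc h hh.2⟩
    · exact fun m => B.finite_row_of_mem_homeoPL hh m
    · exact ⟨fun m => B.finite_row_of_mem_homeoPL hh.1 m, hparc h hh.2⟩
  · intro i τ hτ
    fin_cases i
    · trivial
    · exact B.homeo_mem_homeoLocLip hτ
    · exact hFlip τ hτ
    · exact ⟨hFlip τ (hbdd τ hτ), hFc τ hτ.2⟩
    · exact hFpl τ hτ
    · exact ⟨hFpl τ hτ.1, hFc τ hτ.2⟩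

end FlatFamily

/-! ### Existence of flat families -/

section Existence

variable {N : ℕ} {X A : Set (EuclideanSpace ℝ (Fin N))}

theorem IsFlatAt.mono {x e : EuclideanSpace ℝ (Fin N)} {ε ε' : ℝ} (h : IsFlatAt X x e ε)
    (hε : ε' ≤ ε) : IsFlatAt X x e ε' :=
  fun y hy hyx a ha => h y hy (hyx.trans_le hε) a (ha.trans_le hε)

theorem IsTriangulation.nonempty_flatFamily_unit
    {T : Geometry.SimplicialComplex ℝ (EuclideanSpace ℝ (Fin N))} (hT : IsTriangulation T X)
    (hA : IsClosed A) (hdim : 1 ≤ smallInductiveDimension ↥(X \ A)) :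
    Nonempty (FlatFamily X A Unit) := by
  obtain ⟨x, hx, e, he, ε, hε, hav, hflat⟩ :=
    hT.exists_isFlatAt hA ((hT.one_le_dim_diff_iff hA).1 hdim)
  exact ⟨{
    x := fun _ => x
    e := fun _ => e
    ε := fun _ => min ε (1 / 2)
    x_mem := fun _ => hx
    norm_e := fun _ => he
    ε_pos := fun _ => by positivity
    ε_le := fun _ => min_le_right _ _
    summable_ε := Summable.of_finite
    sep := fun i j h => (h rfl).elim
    flat := fun _ => hflat.mono (min_le_left _ _)
    avoid := fun _ y hy => (min_le_left _ _).trans (hav y hy) }⟩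

/-- Removing A together with a large ball of X leaves a flat point, so flat points exist arbitrarily
far out. -/
theorem IsTriangulation.nonempty_flatFamily_nat
    {T : Geometry.SimplicialComplex ℝ (EuclideanSpace ℝ (Fin N))} (hT : IsTriangulation T X)
    (hA : IsCompact A) (hAX : A ⊆ X)
    (hdim : ∀ K ⊆ X, IsCompact K → 1 ≤ smallInductiveDimension ↥(X \ K)) :
    Nonempty (FlatFamily X A ℕ) := by
  have hex : ∀ R : ℝ, ∃ (x e : EuclideanSpace ℝ (Fin N)) (ε : ℝ), x ∈ X ∧ ‖e‖ = 1 ∧ 0 < ε ∧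
      R < ‖x‖ ∧ (∀ y ∈ A, ε ≤ dist y x) ∧ IsFlatAt X x e ε := by
    intro R
    have hK : IsCompact (A ∪ Metric.closedBall 0 R ∩ X) :=
      hA.union ((isCompact_closedBall _ _).inter_right hT.isClosed)
    obtain ⟨x, hx, e, he, ε, hε, hav, hflat⟩ := hT.exists_isFlatAt hK.isClosed
      ((hT.one_le_dim_diff_iff hK.isClosed).1
        (hdim _ (union_subset hAX inter_subset_right) hK))
    refine ⟨x, e, ε, hx, he, hε, ?_, fun y hy => hav y (Or.inl hy), hflat⟩
    by_contra hR
    have := hav x (Or.inr ⟨by simpa using hR, hx⟩)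
    rw [dist_self] at this
    exact this.not_gt hε
  choose x e ε hx he hε hR hav hflat using hex
  -- Each point is chosen with norm exceeding that of its predecessor by more than 2, which gives
  -- the separation.
  let r : ℕ → ℝ := fun n => Nat.rec 0 (fun _ s => ‖x s‖ + 2) n
  have hr : ∀ n, r (n + 1) = ‖x (r n)‖ + 2 := fun _ => rfl
  have hmono : Monotone r := monotone_nat_of_le_succ fun n => by
    rw [hr]
    linarith [hR (r n)]
  have hsep : ∀ m n, m < n → 2 ≤ dist (x (r m)) (x (r n)) := by
    intro m n hmn
    have h1 := hmono (Nat.succ_le_of_lt hmn)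
    rw [Nat.succ_eq_add_one, hr] at h1
    have h2 := hR (r n)
    have h3 := norm_sub_norm_le (x (r n)) (x (r m))
    rw [dist_comm, dist_eq_norm]
    linarith
  have hgeo : ∀ n : ℕ, (1 / 2 : ℝ) ^ (n + 1) ≤ 1 / 2 := fun n => by
    rw [pow_succ]
    exact mul_le_of_le_one_left (by norm_num) (pow_le_one₀ (by norm_num) (by norm_num))
  exact ⟨{
    x := fun n => x (r n)
    e := fun n => e (r n)
    ε := fun n => min (ε (r n)) ((1 / 2) ^ (n + 1))
    x_mem := fun _ => hx _
    norm_e := fun _ => he _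
    ε_pos := fun n => lt_min (hε _) (by positivity)
    ε_le := fun n => (min_le_right _ _).trans (hgeo n)
    summable_ε := Summable.of_nonneg_of_le (fun n => (lt_min (hε _) (by positivity)).le)
      (fun n => min_le_right _ _) ((summable_nat_add_iff 1).2 summable_geometric_two)
    sep := fun m n h => by
      rcases lt_or_gt_of_ne h with h | h
      · exact hsep m n h
      · rw [dist_comm]
        exact hsep n m h
    flat := fun _ => (hflat _).mono (min_le_left _ _)
    avoid := fun _ y hy => (min_le_left _ _).trans (hav _ y hy) }⟩

end Existence

theorem proposition4p1 (N : ℕ) (X A : Set (EuclideanSpace ℝ (Fin N)))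
    (hX : IsEuclideanPolyhedron X) (hA : IsEuclideanPolyhedron A) (hAX : A ⊆ X)
    (hAc : IsCompact A) (hdim : 1 ≤ smallInductiveDimension ↥(X \ A)) :
    -- (i)
    (∃ Φ : homeoRel X A × (ℕ → ℝ) ≃ₜ homeoRel X A,
      IsStabilityHomeo (homeoTuple X A) modelTuple Φ ∧
      PreservesIdentityComponents (homeoTuple X A) modelTuple Φ) ∧
    -- (ii)
    (¬ IsCompact X →
      (∀ K ⊆ X, IsCompact K → 1 ≤ smallInductiveDimension ↥(X \ K)) →
      ∃ Φ : homeoRel X A × (ℕ → ℕ → ℝ) ≃ₜ homeoRel X A,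
        IsStabilityHomeo (homeoTuple X A) modelTupleInfty Φ ∧
        PreservesIdentityComponents (homeoTuple X A) modelTupleInfty Φ) ∧
    -- the two forms of the hypothesis of (ii) are equivalent
    (∀ T : Geometry.SimplicialComplex ℝ (EuclideanSpace ℝ (Fin N)), IsTriangulation T X →
      ((∀ K ⊆ X, IsCompact K → 1 ≤ smallInductiveDimension ↥(X \ K)) ↔
        (oneSimplices T).Infinite)) := by
  obtain ⟨T, hT⟩ := hX
  refine ⟨?_, fun _ h => ?_, fun T hT => hT.forall_compact_one_le_dim_iff⟩
  · obtain ⟨B⟩ := hT.nonempty_flatFamily_unit hAc.isClosed hdim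
    exact B.exists_stabilityHomeo hT
  · obtain ⟨B⟩ := hT.nonempty_flatFamily_nat hAc hAX h
    exact B.exists_stabilityHomeo_infty hT
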